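/- Let $H_{\mathbb R}$ be a separable real Hilbert space with $\dim H_{\mathbb R}\ge 2$, let $H$ be its complexification (inner product linear in the second variable), and let $x\mapsto\bar x$ be a self-adjoint complex-linear involution of $H$, i.e. $\bar{\bar x}=x$ and $\langle\bar x,y\rangle=\langle x,\bar y\rangle$. Let $\alpha,q\in(-1,1)$. Let $\Sigma(n)$ be the group of bijections $\sigma$ of $\{\pm1,\dots,\pm n\}$ with $\sigma(-k)=-\sigma(k)$, generated by $\pi_0=(1,-1)$ and $\pi_i=(i,i+1)$ (exchanging also $-i$ and $-(i+1)$), $1\le i\le n-1$. For $\sigma\in\Sigma(n)$ let $l_1(\sigma)$ be the number of letters $\pi_0$, and $l_2(\sigma)$ the number of letters $\pi_i$ with $i\ge1$, in an expression of $\sigma$ of minimal length in these generators (these numbers do not depend on the expression). The group $\Sigma(n)$ acts on $H^{\otimes n}$: $\pi_i$ exchanges the $i$-th and $(i+1)$-st tensor factors, and $\pi_0(x_1\otimes\cdots\otimes x_n)=\overline{x_1}\otimes x_2\otimes\cdots\otimes x_n$. On the algebraic full Fock space $\mathcal F=\bigoplus_{n\ge0}H^{\otimes n}$, $H^{\otimes0}=\mathbb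 C\Omega$, with the standard inner product $\langle\cdot,\cdot\rangle_{0,0}$, put $$\langle f,g\rangle_{\alpha,q}=\sum_{n\ge0}\Big\langle f_n,\ \sum_{\sigma\in\Sigma(n)}\alpha^{l_1(\sigma)}q^{l_2(\sigma)}\,\sigma g_n\Big\rangle_{0,0}\qquad(0^0=1),$$ where $f_n,g_n$ are the components in $H^{\otimes n}$; this is a (semi-)inner product. Let $\overline{\mathcal F}$ be the Hilbert space completion of $\mathcal F$ for it. For $x\in H$ let $B^*(x)$ be the right creation operator, $B^*(x)\Omega=x$, $B^*(x)(x_1\otimes\cdots\otimes x_n)=x_1\otimes\cdots\otimes x_n\otimes x$, let $B(x)$ be its adjoint with respect to $\langle\cdot,\cdot\rangle_{\alpha,q}$, and put $G(x)=B(x)+B^*(x)$. Then for every $x\in H_{\mathbb R}$ the creation operator $B^*(x)$ extends to a bounded operator on $\overline{\mathcal F}$, so that $G(x)$ is a well-defined bounded operator on $\overline{\mathcal F}$. Moreover, the vacuum state $T\mapsto\langle\Omega,T\Omega\rangle_{\alpha,q}$ is a trace on the von Neumann algebra generated by $\{G(x):x\in H_{\mathbb R}\}$ on $\overline{\mathcal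 F}$, that is, $\langle\Omega,ST\Omega\rangle_{\alpha,q}=\langle\Omega,TS\Omega\rangle_{\alpha,q}$ for all $S,T$ in it, if and only if $\alpha=0$. -/

import Mathlib

open scoped TensorProduct ComplexOrder

namespace TypeB

/-! ### The hyperoctahedral group -/

/-- The points `±1, …, ±n`: the pair `(k, s)` stands for `s (k + 1)`. -/
abbrev SignedIndex (n : ℕ) : Type := Fin n × ℤˣ

/-- The negation `p ↦ -p` of the points `±1, …, ±n`. -/
def SignedIndex.opp {n : ℕ} (p : SignedIndex n) : SignedIndex n := (p.1, -p.2)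

/-- The Coxeter group of type B: the bijections `σ` of `±1, …, ±n` with `σ (-k) = -σ k`. -/
def Hyperoctahedral (n : ℕ) : Subgroup (Equiv.Perm (SignedIndex n)) where
  carrier := {σ | ∀ p, σ p.opp = (σ p).opp}
  mul_mem' {a b} ha hb p := by
    simp only [Set.mem_ofPred_eq] at ha hb
    simp [Equiv.Perm.mul_apply, ha, hb]
  one_mem' p := rfl
  inv_mem' {a} ha p := by
    simp only [Set.mem_ofPred_eq] at ha
    apply a.injective
    simp [ha]

/-- The generators: `simpleReflection 0` exchanges `1` and `-1`, and for `1 ≤ i ≤ n - 1` the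
element `simpleReflection i` exchanges `i` with `i + 1` and `-i` with `-(i + 1)`. -/
def simpleReflection {n : ℕ} (i : Fin n) : Hyperoctahedral n :=
  if (i : ℕ) = 0 then
    ⟨Equiv.swap (i, 1) (i, -1), by
      intro p
      simp only [SignedIndex.opp, Equiv.swap_apply_def]
      obtain ⟨k, s⟩ := p
      rcases Int.units_eq_one_or s with rfl | rfl <;> by_cases h : k = i <;> simp [h]⟩
  else
    ⟨Equiv.prodCongr (Equiv.swap ⟨(i : ℕ) - 1, by omega⟩ i) (Equiv.refl ℤˣ), fun p => rfl⟩

/-- The product `π_{i₁} ⋯ π_{i_k}` of a word in the generators. -/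
def wordProd {n : ℕ} (w : List (Fin n)) : Hyperoctahedral n := (w.map simpleReflection).prod

/-- `w` is an irreducible form of `σ`: an expression of `σ` of minimal length. -/
def IsReducedWord {n : ℕ} (σ : Hyperoctahedral n) (w : List (Fin n)) : Prop :=
  wordProd w = σ ∧ ∀ w' : List (Fin n), wordProd w' = σ → w.length ≤ w'.length

/-- The number of letters `π₀` in a word. -/
def countZero {n : ℕ} (w : List (Fin n)) : ℕ := w.countP fun i => (i : ℕ) = 0

/-- The number of letters `π_i`, `i ≥ 1`, in a word. -/
def countPos {n : ℕ} (w : List (Fin n)) : ℕ := w.countP fun i => (i : ℕ) ≠ 0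

lemma countZero_cons {n : ℕ} (i : Fin n) (w : List (Fin n)) :
    countZero (i :: w) = countZero w + if (i : ℕ) = 0 then 1 else 0 := by
  by_cases h : (i : ℕ) = 0 <;> simp [countZero, h]

lemma countPos_cons {n : ℕ} (i : Fin n) (w : List (Fin n)) :
    countPos (i :: w) = countPos w + if (i : ℕ) = 0 then 0 else 1 := by
  by_cases h : (i : ℕ) = 0 <;> simp [countPos, h]

lemma countZero_concat {n : ℕ} (i : Fin n) (w : List (Fin n)) :
    countZero (w ++ [i]) = countZero w + if (i : ℕ) = 0 then 1 else 0 := by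
  by_cases h : (i : ℕ) = 0 <;> simp [countZero, h]

lemma countPos_concat {n : ℕ} (i : Fin n) (w : List (Fin n)) :
    countPos (w ++ [i]) = countPos w + if (i : ℕ) = 0 then 0 else 1 := by
  by_cases h : (i : ℕ) = 0 <;> simp [countPos, h]

lemma countZero_add_countPos {n : ℕ} (w : List (Fin n)) :
    countZero w + countPos w = w.length := by
  induction w with
  | nil => rfl
  | cons i w ih =>
    rw [countZero_cons, countPos_cons, List.length_cons]
    by_cases h : (i : ℕ) = 0 <;> simp [h] <;> omega

/-! #### Counting separating hyperplanes -/

/-- The integer `s (k + 1)` that the pair `(k, s)` stands for. -/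
def SignedIndex.val {n : ℕ} (p : SignedIndex n) : ℤ := (p.2 : ℤ) * ((p.1 : ℕ) + 1)

lemma hyp_opp {n : ℕ} (σ : Hyperoctahedral n) (p : SignedIndex n) :
    (σ : Equiv.Perm (SignedIndex n)) p.opp = ((σ : Equiv.Perm (SignedIndex n)) p).opp := σ.2 p

lemma SignedIndex.val_opp {n : ℕ} (p : SignedIndex n) : p.opp.val = -p.val := by
  simp [SignedIndex.opp, SignedIndex.val]

lemma hyp_fst_eq {n : ℕ} (σ : Hyperoctahedral n) (p q : SignedIndex n) :
    ((σ : Equiv.Perm (SignedIndex n)) p).1 = ((σ : Equiv.Perm (SignedIndex n)) q).1 ↔ p.1 = q.1 := by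
  have key : ∀ (τ : Hyperoctahedral n) (p q : SignedIndex n), p.1 = q.1 →
      ((τ : Equiv.Perm (SignedIndex n)) p).1 = ((τ : Equiv.Perm (SignedIndex n)) q).1 := by
    intro τ p q h
    have : p = q ∨ p = q.opp := by
      obtain ⟨k, s⟩ := p
      obtain ⟨l, t⟩ := q
      simp only at h
      subst h
      rcases Int.units_eq_one_or s with rfl | rfl <;>
        rcases Int.units_eq_one_or t with rfl | rfl <;> simp [SignedIndex.opp]
    rcases this with rfl | rfl
    · rfl
    · rw [hyp_opp]; rfl
  refine ⟨fun h => ?_, key σ p q⟩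
  simpa using key σ⁻¹ _ _ h

/-- Do `σ` and `τ` lie on different sides of the hyperplane of the point `a`? -/
def sep₁ {n : ℕ} (σ τ : Hyperoctahedral n) (a : SignedIndex n) : Prop :=
  ¬ (((σ⁻¹ : Hyperoctahedral n) : Equiv.Perm (SignedIndex n)) a).2 = (((τ⁻¹ : Hyperoctahedral n) : Equiv.Perm (SignedIndex n)) a).2

/-- Do `σ` and `τ` order the points `a` and `b` differently? -/
def sep₂ {n : ℕ} (σ τ : Hyperoctahedral n) (a b : SignedIndex n) : Prop :=
  ¬ ((((σ⁻¹ : Hyperoctahedral n) : Equiv.Perm (SignedIndex n)) a).val < (((σ⁻¹ : Hyperoctahedral n) : Equiv.Perm (SignedIndex n)) b).val ↔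
    (((τ⁻¹ : Hyperoctahedral n) : Equiv.Perm (SignedIndex n)) a).val < (((τ⁻¹ : Hyperoctahedral n) : Equiv.Perm (SignedIndex n)) b).val)

open Classical in
/-- Twice the number of hyperplanes `x_k = 0` that separate `σ` and `τ`. -/
noncomputable def sepCard₁ {n : ℕ} (σ τ : Hyperoctahedral n) : ℕ :=
  (Finset.univ.filter fun a : SignedIndex n => sep₁ σ τ a).card

open Classical in
/-- Four times the number of hyperplanes `x_j = ± x_k`, `j ≠ k`, that separate `σ` and `τ`. -/
noncomputable def sepCard₂ {n : ℕ} (σ τ : Hyperoctahedral n) : ℕ :=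
  (Finset.univ.filter fun p : SignedIndex n × SignedIndex n =>
    p.1.1 ≠ p.2.1 ∧ sep₂ σ τ p.1 p.2).card

lemma sepCard₁_mul_left {n : ℕ} (ρ σ τ : Hyperoctahedral n) :
    sepCard₁ (ρ * σ) (ρ * τ) = sepCard₁ σ τ := by
  classical
  unfold sepCard₁
  refine Finset.card_bij (fun a _ => ((ρ⁻¹ : Hyperoctahedral n) : Equiv.Perm (SignedIndex n)) a) ?_ ?_ ?_
  · intro a ha
    simp only [Finset.mem_filter, Finset.mem_univ, true_and] at ha ⊢
    simpa [sep₁, mul_inv_rev] using ha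
  · intro a _ b _ h
    exact Equiv.injective _ h
  · intro b hb
    refine ⟨(ρ : Equiv.Perm (SignedIndex n)) b, ?_, by simp⟩
    simp only [Finset.mem_filter, Finset.mem_univ, true_and] at hb ⊢
    simpa [sep₁, mul_inv_rev] using hb

lemma sepCard₂_mul_left {n : ℕ} (ρ σ τ : Hyperoctahedral n) :
    sepCard₂ (ρ * σ) (ρ * τ) = sepCard₂ σ τ := by
  classical
  unfold sepCard₂
  refine Finset.card_bij (fun p _ => (((ρ⁻¹ : Hyperoctahedral n) : Equiv.Perm (SignedIndex n)) p.1,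
    ((ρ⁻¹ : Hyperoctahedral n) : Equiv.Perm (SignedIndex n)) p.2)) ?_ ?_ ?_
  · intro a ha
    simp only [Finset.mem_filter, Finset.mem_univ, true_and, ne_eq, hyp_fst_eq] at ha ⊢
    simpa [sep₂, mul_inv_rev] using ha
  · intro a _ b _ h
    simp only [Prod.mk.injEq, EmbeddingLike.apply_eq_iff_eq] at h
    exact Prod.ext h.1 h.2
  · intro b hb
    refine ⟨((ρ : Equiv.Perm (SignedIndex n)) b.1, (ρ : Equiv.Perm (SignedIndex n)) b.2), ?_, by simp⟩
    simp only [Finset.mem_filter, Finset.mem_univ, true_and, ne_eq, hyp_fst_eq] at hb ⊢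
    simpa [sep₂, mul_inv_rev] using hb

lemma sepCard₁_triangle {n : ℕ} (ρ σ τ : Hyperoctahedral n) :
    sepCard₁ ρ τ ≤ sepCard₁ ρ σ + sepCard₁ σ τ := by
  classical
  unfold sepCard₁
  refine le_trans (Finset.card_le_card ?_) (Finset.card_union_le _ _)
  intro a ha
  simp only [Finset.mem_filter, Finset.mem_univ, true_and, Finset.mem_union] at ha ⊢
  unfold sep₁ at *
  by_contra hc
  push Not at hc
  exact ha (hc.1.trans hc.2)

lemma sepCard₂_triangle {n : ℕ} (ρ σ τ : Hyperoctahedral n) :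
    sepCard₂ ρ τ ≤ sepCard₂ ρ σ + sepCard₂ σ τ := by
  classical
  unfold sepCard₂
  refine le_trans (Finset.card_le_card ?_) (Finset.card_union_le _ _)
  intro a ha
  simp only [Finset.mem_filter, Finset.mem_univ, true_and, Finset.mem_union] at ha ⊢
  unfold sep₂ at *
  tauto

lemma simpleReflection_zero_apply {n : ℕ} (i : Fin n) (hi : (i : ℕ) = 0) (p : SignedIndex n) :
    ((simpleReflection i : Hyperoctahedral n) : Equiv.Perm (SignedIndex n)) p =
      if p.1 = i then p.opp else p := by
  obtain ⟨k, s⟩ := p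
  simp only [simpleReflection, hi, if_true, Equiv.swap_apply_def, SignedIndex.opp]
  rcases Int.units_eq_one_or s with rfl | rfl <;> by_cases h : k = i <;> simp [h]

lemma simpleReflection_pos_apply {n : ℕ} (i : Fin n) (hi : (i : ℕ) ≠ 0) (p : SignedIndex n) :
    ((simpleReflection i : Hyperoctahedral n) : Equiv.Perm (SignedIndex n)) p =
      (Equiv.swap ⟨(i : ℕ) - 1, by omega⟩ i p.1, p.2) := by
  simp [simpleReflection, hi, Equiv.prodCongr, Prod.map]

lemma simpleReflection_mul_self {n : ℕ} (i : Fin n) :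
    simpleReflection i * simpleReflection i = 1 := by
  apply Subtype.ext
  ext1 p
  by_cases hi : (i : ℕ) = 0
  · simp only [Subgroup.coe_mul, Equiv.Perm.mul_apply, simpleReflection_zero_apply i hi]
    obtain ⟨k, s⟩ := p
    by_cases h : k = i <;> simp [h, SignedIndex.opp]
  · simp [Subgroup.coe_mul, Equiv.Perm.mul_apply, simpleReflection_pos_apply i hi]

lemma simpleReflection_inv {n : ℕ} (i : Fin n) :
    (simpleReflection i)⁻¹ = simpleReflection i :=
  inv_eq_of_mul_eq_one_left (simpleReflection_mul_self i)

lemma SignedIndex.val_injective {n : ℕ} :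
    Function.Injective (SignedIndex.val : SignedIndex n → ℤ) := by
  rintro ⟨k, s⟩ ⟨l, t⟩ h
  simp only [SignedIndex.val] at h
  rcases Int.units_eq_one_or s with rfl | rfl <;>
    rcases Int.units_eq_one_or t with rfl | rfl <;> simp [Fin.ext_iff] at h ⊢ <;> omega

/-- For the generator `π₀` only the hyperplane `x_1 = 0` separates. -/
lemma sep₁_one_zero {n : ℕ} (i : Fin n) (hi : (i : ℕ) = 0) (a : SignedIndex n) :
    sep₁ 1 (simpleReflection i) a ↔ a.1 = i := by
  simp only [sep₁, simpleReflection_inv, simpleReflection_zero_apply i hi]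
  obtain ⟨k, s⟩ := a
  by_cases h : k = i <;> simp [h, SignedIndex.opp]

lemma sep₁_one_pos {n : ℕ} (i : Fin n) (hi : (i : ℕ) ≠ 0) (a : SignedIndex n) :
    ¬ sep₁ 1 (simpleReflection i) a := by
  simp [sep₁, simpleReflection_inv, simpleReflection_pos_apply i hi]

lemma sep₂_one_zero {n : ℕ} (i : Fin n) (hi : (i : ℕ) = 0) (a b : SignedIndex n)
    (hab : a.1 ≠ b.1) : ¬ sep₂ 1 (simpleReflection i) a b := by
  simp only [sep₂, simpleReflection_inv, simpleReflection_zero_apply i hi, not_not]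
  obtain ⟨k, s⟩ := a
  obtain ⟨l, t⟩ := b
  simp only [ne_eq, Fin.ext_iff] at hab
  rcases Int.units_eq_one_or s with rfl | rfl <;>
    rcases Int.units_eq_one_or t with rfl | rfl <;>
    by_cases h : k = i <;> by_cases h' : l = i <;>
    simp [h, h', SignedIndex.opp, SignedIndex.val, Fin.ext_iff] at * <;> omega

lemma sep₂_one_pos {n : ℕ} (i j : Fin n) (hj : (j : ℕ) + 1 = i) (a b : SignedIndex n)
    (hab : a.1 ≠ b.1) : sep₂ 1 (simpleReflection i) a b ↔
      (a.2 = b.2 ∧ (a.1 = j ∧ b.1 = i ∨ a.1 = i ∧ b.1 = j)) := by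
  have hi : (i : ℕ) ≠ 0 := by omega
  have hj' : (⟨(i : ℕ) - 1, by omega⟩ : Fin n) = j := Fin.ext (by simp; omega)
  simp only [sep₂, simpleReflection_inv, simpleReflection_pos_apply i hi, hj',
    Equiv.swap_apply_def]
  obtain ⟨k, s⟩ := a
  obtain ⟨l, t⟩ := b
  have hij : i ≠ j := by rintro rfl; omega
  simp only [ne_eq] at hab
  rcases Int.units_eq_one_or s with rfl | rfl <;>
    rcases Int.units_eq_one_or t with rfl | rfl <;>
    by_cases h1 : k = i <;> by_cases h2 : l = i <;>
    by_cases h3 : k = j <;> by_cases h4 : l = j <;>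
    simp_all [SignedIndex.val, Fin.ext_iff] <;> omega

lemma sepCard₁_one_zero {n : ℕ} (i : Fin n) (hi : (i : ℕ) = 0) :
    sepCard₁ 1 (simpleReflection i) = 2 := by
  classical
  have : (Finset.univ.filter fun a : SignedIndex n => sep₁ 1 (simpleReflection i) a) =
      {(i, 1), (i, -1)} := by
    ext ⟨k, s⟩
    simp only [Finset.mem_filter, Finset.mem_univ, true_and, sep₁_one_zero i hi]
    rcases Int.units_eq_one_or s with rfl | rfl <;> simp
  rw [sepCard₁, this, Finset.card_pair (by simp)]

lemma sepCard₁_one_pos {n : ℕ} (i : Fin n) (hi : (i : ℕ) ≠ 0) :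
    sepCard₁ 1 (simpleReflection i) = 0 := by
  classical
  simp [sepCard₁, sep₁_one_pos i hi]

lemma sepCard₂_one_zero {n : ℕ} (i : Fin n) (hi : (i : ℕ) = 0) :
    sepCard₂ 1 (simpleReflection i) = 0 := by
  classical
  rw [sepCard₂, Finset.card_eq_zero, Finset.filter_eq_empty_iff]
  rintro ⟨a, b⟩ _ ⟨h1, h2⟩
  exact sep₂_one_zero i hi a b h1 h2

lemma sepCard₂_one_pos {n : ℕ} (i j : Fin n) (hj : (j : ℕ) + 1 = i) :
    sepCard₂ 1 (simpleReflection i) = 4 := by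
  classical
  have hij : i ≠ j := by rintro rfl; omega
  have : (Finset.univ.filter fun p : SignedIndex n × SignedIndex n =>
      p.1.1 ≠ p.2.1 ∧ sep₂ 1 (simpleReflection i) p.1 p.2) =
      {((i, 1), (j, 1)), ((j, 1), (i, 1)), ((i, -1), (j, -1)), ((j, -1), (i, -1))} := by
    ext ⟨⟨k, s⟩, ⟨l, t⟩⟩
    simp only [Finset.mem_filter, Finset.mem_univ, true_and]
    rw [and_congr_right (fun h => sep₂_one_pos i j hj (k, s) (l, t) h)]
    rcases Int.units_eq_one_or s with rfl | rfl <;>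
      rcases Int.units_eq_one_or t with rfl | rfl <;> simp <;> grind
  rw [sepCard₂, this]
  rw [Finset.card_insert_of_notMem, Finset.card_insert_of_notMem, Finset.card_pair] <;>
    simp [hij, hij.symm]

lemma sepCard_wordProd_le {n : ℕ} (w : List (Fin n)) :
    sepCard₁ 1 (wordProd w) ≤ 2 * countZero w ∧ sepCard₂ 1 (wordProd w) ≤ 4 * countPos w := by
  induction w with
  | nil => simp [wordProd, sepCard₁, sepCard₂, sep₁, sep₂]
  | cons i w ih =>
    have e : wordProd (i :: w) = simpleReflection i * wordProd w := by simp [wordProd]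
    have h1 := sepCard₁_triangle 1 (simpleReflection i) (simpleReflection i * wordProd w)
    have h2 := sepCard₂_triangle 1 (simpleReflection i) (simpleReflection i * wordProd w)
    have e1 := sepCard₁_mul_left (simpleReflection i) 1 (wordProd w)
    have e2 := sepCard₂_mul_left (simpleReflection i) 1 (wordProd w)
    rw [mul_one] at e1 e2
    rw [e1] at h1
    rw [e2] at h2
    rw [e]
    rw [countZero_cons, countPos_cons]
    by_cases hi : (i : ℕ) = 0
    · rw [sepCard₁_one_zero i hi] at h1
      rw [sepCard₂_one_zero i hi] at h2
      simp only [hi, if_true, if_false]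
      omega
    · rw [sepCard₁_one_pos i hi] at h1
      rw [sepCard₂_one_pos i ⟨(i : ℕ) - 1, by omega⟩ (by simp; omega)] at h2
      simp only [hi, if_true, if_false]
      omega

lemma exists_descent {n : ℕ} (σ : Hyperoctahedral n) (hσ : σ ≠ 1) :
    (∃ i : Fin n, (i : ℕ) = 0 ∧ ((σ : Equiv.Perm (SignedIndex n)) (i, 1)).2 = -1) ∨
    (∃ i j : Fin n, (j : ℕ) + 1 = i ∧
      ((σ : Equiv.Perm (SignedIndex n)) (i, 1)).val < ((σ : Equiv.Perm (SignedIndex n)) (j, 1)).val) := by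
  by_contra hc
  push Not at hc
  obtain ⟨h0, h1⟩ := hc
  apply hσ
  have step : ∀ i j : Fin n, (j : ℕ) + 1 = i →
      ((σ : Equiv.Perm (SignedIndex n)) (j, 1)).val < ((σ : Equiv.Perm (SignedIndex n)) (i, 1)).val := by
    intro i j hij
    refine lt_of_le_of_ne (h1 i j hij) fun h => ?_
    have := (σ : Equiv.Perm (SignedIndex n)).injective (SignedIndex.val_injective h)
    simp only [Prod.mk.injEq, and_true] at this
    subst this
    omega
  have low : ∀ m : ℕ, ∀ hm : m < n, (m : ℤ) + 1 ≤ ((σ : Equiv.Perm (SignedIndex n)) (⟨m, hm⟩, 1)).val := by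
    intro m
    induction m with
    | zero =>
      intro hm
      have := h0 ⟨0, hm⟩ rfl
      rcases Int.units_eq_one_or ((σ : Equiv.Perm (SignedIndex n)) (⟨0, hm⟩, 1)).2 with h | h
      · simp [SignedIndex.val, h]
      · exact absurd h this
    | succ m ih =>
      intro hm
      have := ih (by omega)
      have := step ⟨m + 1, hm⟩ ⟨m, by omega⟩ rfl
      push_cast
      omega
  have pos : ∀ k : Fin n, ((σ : Equiv.Perm (SignedIndex n)) (k, 1)).2 = 1 := by
    intro k
    rcases Int.units_eq_one_or ((σ : Equiv.Perm (SignedIndex n)) (k, 1)).2 with h | h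
    · exact h
    · have := low k k.2
      simp [SignedIndex.val, h] at this
      omega
  have mono : StrictMono fun k : Fin n => ((σ : Equiv.Perm (SignedIndex n)) (k, 1)).1 := by
    cases n with
    | zero => exact fun a => a.elim0
    | succ n =>
      refine Fin.strictMono_iff_lt_succ.2 fun k => ?_
      have := step k.succ k.castSucc (by simp)
      simp only [SignedIndex.val, pos] at this
      simp at this
      exact this
  have hid : ∀ k : Fin n, ((σ : Equiv.Perm (SignedIndex n)) (k, 1)).1 = k := by
    intro k
    exact congrFun (mono.eq_id) k
  have h1' : ∀ k : Fin n, (σ : Equiv.Perm (SignedIndex n)) (k, 1) = (k, 1) := fun k =>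
    Prod.ext (hid k) (pos k)
  apply Subtype.ext
  ext1 ⟨k, s⟩
  rcases Int.units_eq_one_or s with rfl | rfl
  · simp [h1']
  · have := hyp_opp σ (k, 1)
    simpa [SignedIndex.opp, h1'] using this

lemma sepCard₁_descent {n : ℕ} (σ : Hyperoctahedral n) (i : Fin n) (hi : (i : ℕ) = 0)
    (h : ((σ : Equiv.Perm (SignedIndex n)) (i, 1)).2 = -1) :
    sepCard₁ 1 (σ * simpleReflection i) + 2 ≤ sepCard₁ 1 σ := by
  classical
  have e := sepCard₁_mul_left σ 1 (simpleReflection i)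
  rw [mul_one, sepCard₁_one_zero i hi] at e
  rw [← e]
  unfold sepCard₁
  have key : ∀ a, sep₁ σ (σ * simpleReflection i) a → sep₁ 1 σ a := by
    intro a ha
    obtain ⟨⟨k, s⟩, rfl⟩ := (σ : Equiv.Perm (SignedIndex n)).surjective a
    have : k = i := by
      by_contra hk
      simp [sep₁, mul_inv_rev, simpleReflection_inv, simpleReflection_zero_apply i hi, hk] at ha
    subst this
    have ho := hyp_opp σ (k, 1)
    rcases Int.units_eq_one_or s with rfl | rfl
    · simp [sep₁, h]
    · have ho' : ((σ : Equiv.Perm (SignedIndex n)) (k, -1)).2 = 1 := by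
        have : SignedIndex.opp ((k, 1) : SignedIndex n) = (k, -1) := rfl
        rw [← this, ho]
        simp [SignedIndex.opp, h]
      simp [sep₁, ho']
  rw [← Finset.card_union_of_disjoint]
  · apply Finset.card_le_card
    intro a ha
    simp only [Finset.mem_filter, Finset.mem_univ, true_and, Finset.mem_union] at ha ⊢
    rcases ha with ha | ha
    · by_contra hc
      have h3 : sep₁ σ (σ * simpleReflection i) a := by
        unfold sep₁ at *
        intro h4
        push Not at hc
        exact ha (hc.trans h4)
      exact hc (key a h3)
    · exact key a ha
  · rw [Finset.disjoint_left]
    intro a ha hb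
    simp only [Finset.mem_filter, Finset.mem_univ, true_and] at ha hb
    have h3 := key a hb
    unfold sep₁ at *
    revert ha hb h3
    generalize (((1 : Hyperoctahedral n)⁻¹ : Hyperoctahedral n) : Equiv.Perm (SignedIndex n)) a = x
    generalize ((σ⁻¹ : Hyperoctahedral n) : Equiv.Perm (SignedIndex n)) a = y
    generalize (((σ * simpleReflection i)⁻¹ : Hyperoctahedral n) : Equiv.Perm (SignedIndex n)) a = z
    rcases Int.units_eq_one_or x.2 with hx | hx <;> rcases Int.units_eq_one_or y.2 with hy | hy <;>
      rcases Int.units_eq_one_or z.2 with hz | hz <;> simp [hx, hy, hz]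

lemma sepCard₂_descent {n : ℕ} (σ : Hyperoctahedral n) (i j : Fin n) (hj : (j : ℕ) + 1 = i)
    (h : ((σ : Equiv.Perm (SignedIndex n)) (i, 1)).val < ((σ : Equiv.Perm (SignedIndex n)) (j, 1)).val) :
    sepCard₂ 1 (σ * simpleReflection i) + 4 ≤ sepCard₂ 1 σ := by
  classical
  have e := sepCard₂_mul_left σ 1 (simpleReflection i)
  rw [mul_one, sepCard₂_one_pos i j hj] at e
  rw [← e]
  unfold sepCard₂
  have key : ∀ a b, a.1 ≠ b.1 → sep₂ σ (σ * simpleReflection i) a b → sep₂ 1 σ a b := by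
    intro a b hab ha
    obtain ⟨a, rfl⟩ := (σ : Equiv.Perm (SignedIndex n)).surjective a
    obtain ⟨b, rfl⟩ := (σ : Equiv.Perm (SignedIndex n)).surjective b
    rw [Ne, hyp_fst_eq] at hab
    have h2 : sep₂ 1 (simpleReflection i) a b := by
      simpa [sep₂, mul_inv_rev] using ha
    rw [sep₂_one_pos i j hj a b hab] at h2
    obtain ⟨k, s⟩ := a
    obtain ⟨l, t⟩ := b
    obtain ⟨rfl, h2⟩ : s = t ∧ (k = j ∧ l = i ∨ k = i ∧ l = j) := h2
    have hoi : (((σ : Equiv.Perm (SignedIndex n)) (i, -1))).val = -((σ : Equiv.Perm (SignedIndex n)) (i, 1)).val := by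
      rw [← SignedIndex.val_opp, ← hyp_opp]; rfl
    have hoj : (((σ : Equiv.Perm (SignedIndex n)) (j, -1))).val = -((σ : Equiv.Perm (SignedIndex n)) (j, 1)).val := by
      rw [← SignedIndex.val_opp, ← hyp_opp]; rfl
    have v1 : SignedIndex.val (i, 1) = (i : ℤ) + 1 := by simp [SignedIndex.val]
    have v2 : SignedIndex.val (j, 1) = (j : ℤ) + 1 := by simp [SignedIndex.val]
    have v3 : SignedIndex.val (i, -1) = -((i : ℤ) + 1) := by simp [SignedIndex.val]
    have v4 : SignedIndex.val (j, -1) = -((j : ℤ) + 1) := by simp [SignedIndex.val]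
    have hj' : (i : ℤ) = (j : ℤ) + 1 := by omega
    rcases h2 with ⟨rfl, rfl⟩ | ⟨rfl, rfl⟩ <;>
      rcases Int.units_eq_one_or s with rfl | rfl <;>
      simp [sep₂, hoi, hoj, v1, v2, v3, v4] <;> omega
  rw [← Finset.card_union_of_disjoint]
  · apply Finset.card_le_card
    rintro ⟨a, b⟩ ha
    simp only [Finset.mem_filter, Finset.mem_univ, true_and, Finset.mem_union] at ha ⊢
    rcases ha with ha | ha
    · refine ⟨ha.1, ?_⟩
      have := key a b ha.1
      unfold sep₂ at *
      tauto
    · exact ⟨ha.1, key a b ha.1 ha.2⟩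
  · rw [Finset.disjoint_left]
    rintro ⟨a, b⟩ ha hb
    simp only [Finset.mem_filter, Finset.mem_univ, true_and] at ha hb
    have h3 := key a b ha.1
    unfold sep₂ at *
    tauto

lemma exists_word {n : ℕ} (σ : Hyperoctahedral n) : ∃ w : List (Fin n), wordProd w = σ ∧
    2 * countZero w ≤ sepCard₁ 1 σ ∧ 4 * countPos w ≤ sepCard₂ 1 σ := by
  induction h : sepCard₁ 1 σ + sepCard₂ 1 σ using Nat.strong_induction_on generalizing σ with
  | _ N ih =>
  by_cases hσ : σ = 1
  · exact ⟨[], by simp [wordProd, hσ], by simp [countZero], by simp [countPos]⟩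
  have fin : ∀ i : Fin n, ∀ w, wordProd w = σ * simpleReflection i →
      wordProd (w ++ [i]) = σ := by
    intro i w hw
    have : wordProd (w ++ [i]) = wordProd w * simpleReflection i := by simp [wordProd]
    rw [this, hw, mul_assoc, simpleReflection_mul_self, mul_one]
  rcases exists_descent σ hσ with ⟨i, hi, hd⟩ | ⟨i, j, hj, hd⟩
  · have h1 := sepCard₁_descent σ i hi hd
    have h2 := sepCard₂_triangle 1 σ (σ * simpleReflection i)
    have e := sepCard₂_mul_left σ 1 (simpleReflection i)
    rw [mul_one, sepCard₂_one_zero i hi] at e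
    obtain ⟨w, hw, hw1, hw2⟩ := ih _ (by omega) (σ * simpleReflection i) rfl
    refine ⟨w ++ [i], fin i w hw, ?_, ?_⟩
    · rw [countZero_concat]
      simp only [hi, if_true, if_false]; omega
    · rw [countPos_concat]
      simp only [hi, if_true, if_false]; omega
  · have hi : (i : ℕ) ≠ 0 := by omega
    have h1 := sepCard₂_descent σ i j hj hd
    have h2 := sepCard₁_triangle 1 σ (σ * simpleReflection i)
    have e := sepCard₁_mul_left σ 1 (simpleReflection i)
    rw [mul_one, sepCard₁_one_pos i hi] at e
    obtain ⟨w, hw, hw1, hw2⟩ := ih _ (by omega) (σ * simpleReflection i) rfl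
    refine ⟨w ++ [i], fin i w hw, ?_, ?_⟩
    · rw [countZero_concat]
      simp only [hi, if_true, if_false]; omega
    · rw [countPos_concat]
      simp only [hi, if_true, if_false]; omega

lemma IsReducedWord.count_eq {n : ℕ} {σ : Hyperoctahedral n} {w : List (Fin n)}
    (hw : IsReducedWord σ w) :
    2 * countZero w = sepCard₁ 1 σ ∧ 4 * countPos w = sepCard₂ 1 σ := by
  obtain ⟨w', hw', h1, h2⟩ := exists_word σ
  have h3 := sepCard_wordProd_le w
  rw [hw.1] at h3
  have h4 := hw.2 w' hw'
  rw [← countZero_add_countPos, ← countZero_add_countPos] at h4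
  omega

lemma exists_isReducedWord {n : ℕ} (σ : Hyperoctahedral n) : ∃ w, IsReducedWord σ w := by
  obtain ⟨w, hw, h1, h2⟩ := exists_word σ
  refine ⟨w, hw, fun w' hw' => ?_⟩
  have h3 := sepCard_wordProd_le w'
  rw [hw'] at h3
  rw [← countZero_add_countPos, ← countZero_add_countPos]
  omega

/-- `l₁ σ`: the number of `π₀` in an irreducible form of `σ`. -/
noncomputable def l₁ {n : ℕ} (σ : Hyperoctahedral n) : ℕ :=
  countZero (exists_isReducedWord σ).choose

/-- `l₂ σ`: the number of `π_i`, `i ≥ 1`, in an irreducible form of `σ`. -/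
noncomputable def l₂ {n : ℕ} (σ : Hyperoctahedral n) : ℕ :=
  countPos (exists_isReducedWord σ).choose

lemma two_mul_l₁ {n : ℕ} (σ : Hyperoctahedral n) : 2 * l₁ σ = sepCard₁ 1 σ :=
  (exists_isReducedWord σ).choose_spec.count_eq.1

lemma four_mul_l₂ {n : ℕ} (σ : Hyperoctahedral n) : 4 * l₂ σ = sepCard₂ 1 σ :=
  (exists_isReducedWord σ).choose_spec.count_eq.2

/-- `l₁` and `l₂` do not depend on the chosen irreducible form. -/
lemma IsReducedWord.l_eq {n : ℕ} {σ : Hyperoctahedral n} {w : List (Fin n)}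
    (hw : IsReducedWord σ w) : countZero w = l₁ σ ∧ countPos w = l₂ σ := by
  have h := hw.count_eq
  have h1 := two_mul_l₁ σ
  have h2 := four_mul_l₂ σ
  omega

/-! #### The weights `α ^ l₁ * q ^ l₂` form a positive semidefinite kernel -/

lemma sum_signs (f : ℤˣ → ℕ) : ∑ s, f s = f 1 + f (-1) := by
  rw [show (Finset.univ : Finset ℤˣ) = {1, -1} from rfl, Finset.sum_pair (by decide)]

lemma sep₁_opp {n : ℕ} (σ τ : Hyperoctahedral n) (k : Fin n) :
    sep₁ σ τ (k, -1) ↔ sep₁ σ τ (k, 1) := by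
  have : ((k, -1) : SignedIndex n) = SignedIndex.opp (k, 1) := rfl
  simp only [sep₁, this, hyp_opp]
  simp [SignedIndex.opp]

lemma sep₂_opp {n : ℕ} (σ τ : Hyperoctahedral n) (a b : SignedIndex n) :
    sep₂ σ τ a.opp b.opp ↔ sep₂ σ τ b a := by
  simp only [sep₂, hyp_opp, SignedIndex.val_opp, neg_lt_neg_iff]

lemma sep₂_swap {n : ℕ} (σ τ : Hyperoctahedral n) (a b : SignedIndex n) (hab : a.1 ≠ b.1) :
    sep₂ σ τ b a ↔ sep₂ σ τ a b := by
  have key : ∀ ρ : Hyperoctahedral n,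
      ((ρ : Equiv.Perm (SignedIndex n)) b).val < ((ρ : Equiv.Perm (SignedIndex n)) a).val ↔
      ¬ ((ρ : Equiv.Perm (SignedIndex n)) a).val < ((ρ : Equiv.Perm (SignedIndex n)) b).val := by
    intro ρ
    have : ((ρ : Equiv.Perm (SignedIndex n)) a).val ≠ ((ρ : Equiv.Perm (SignedIndex n)) b).val := by
      intro h
      have := (ρ : Equiv.Perm (SignedIndex n)).injective (SignedIndex.val_injective h)
      exact hab (congrArg Prod.fst this)
    omega
  unfold sep₂
  rw [key, key]
  tauto

open Classical in
lemma sepCard₁_eq {n : ℕ} (σ τ : Hyperoctahedral n) :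
    sepCard₁ σ τ = 2 * ∑ k : Fin n, if sep₁ σ τ (k, 1) then 1 else 0 := by
  rw [sepCard₁, Finset.card_filter, Fintype.sum_prod_type, Finset.mul_sum]
  refine Finset.sum_congr rfl fun k _ => ?_
  rw [sum_signs]
  simp only [sep₁_opp]
  ring

open Classical in
lemma sepCard₂_eq {n : ℕ} (σ τ : Hyperoctahedral n) :
    sepCard₂ σ τ = 4 * ∑ p : Fin n × Fin n × ℤˣ,
      if p.1 < p.2.1 ∧ sep₂ σ τ (p.1, 1) p.2 then 1 else 0 := by
  set g : Fin n → Fin n → ℕ := fun i j =>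
    ∑ t : ℤˣ, if sep₂ σ τ (i, 1) (j, t) then 1 else 0 with hg
  have hsymm : ∀ i j, i ≠ j → g i j = g j i := by
    intro i j hij
    simp only [hg]
    rw [sum_signs, sum_signs]
    have e1 := sep₂_swap σ τ (i, 1) (j, 1) hij
    have e2 := sep₂_opp σ τ (i, 1) (j, -1)
    simp only [SignedIndex.opp, neg_neg] at e2
    have e3 := sep₂_swap σ τ (i, -1) (j, 1) hij
    have e4 := sep₂_swap σ τ (i, 1) (j, -1) hij
    simp only [e1, ← e4, ← e2, ← e3]
  have e : sepCard₂ σ τ = ∑ i, ∑ j, if i ≠ j then 2 * g i j else 0 := by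
    rw [sepCard₂, Finset.card_filter]
    simp only [Fintype.sum_prod_type]
    refine Finset.sum_congr rfl fun i _ => ?_
    rw [Finset.sum_comm]
    refine Finset.sum_congr rfl fun j _ => ?_
    by_cases hij : i = j
    · simp [hij]
    · simp only [hg, hij, ne_eq, not_false_eq_true, true_and, if_true]
      simp only [sum_signs]
      have e1 := sep₂_opp σ τ (i, 1) (j, 1)
      have e2 := sep₂_opp σ τ (i, 1) (j, -1)
      have e3 := sep₂_swap σ τ (i, 1) (j, 1) hij
      have e4 := sep₂_swap σ τ (i, 1) (j, -1) hij
      simp only [SignedIndex.opp, neg_neg] at e1 e2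
      simp only [e1, e2, e3, e4]
      ring
  have e' : (∑ p : Fin n × Fin n × ℤˣ,
      if p.1 < p.2.1 ∧ sep₂ σ τ (p.1, 1) p.2 then 1 else 0) =
      ∑ i, ∑ j, if i < j then g i j else 0 := by
    simp only [Fintype.sum_prod_type, hg]
    refine Finset.sum_congr rfl fun i _ => Finset.sum_congr rfl fun j _ => ?_
    by_cases hij : i < j <;> simp [hij]
  have e'' : (∑ i, ∑ j, if i < j then g i j else 0) = ∑ i, ∑ j, if j < i then g i j else 0 := by
    rw [Finset.sum_comm]
    refine Finset.sum_congr rfl fun i _ => Finset.sum_congr rfl fun j _ => ?_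
    by_cases hij : j < i
    · simp [hij, hsymm j i hij.ne]
    · simp [hij]
  have : sepCard₂ σ τ = 2 * (∑ i, ∑ j, if i < j then g i j else 0) +
      2 * ∑ i, ∑ j, if j < i then g i j else 0 := by
    rw [e]
    simp only [Finset.mul_sum, ← Finset.sum_add_distrib]
    refine Finset.sum_congr rfl fun i _ => Finset.sum_congr rfl fun j _ => ?_
    rcases lt_trichotomy i j with h | h | h
    · simp [h, h.ne, h.not_gt]
    · simp [h]
    · simp [h, h.ne', h.not_gt]
  rw [e', this, ← e'']
  ring

lemma l₁_inv_mul {n : ℕ} (σ τ : Hyperoctahedral n) : 2 * l₁ (σ⁻¹ * τ) = sepCard₁ σ τ := by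
  rw [two_mul_l₁, ← sepCard₁_mul_left σ]
  simp

lemma l₂_inv_mul {n : ℕ} (σ τ : Hyperoctahedral n) : 4 * l₂ (σ⁻¹ * τ) = sepCard₂ σ τ := by
  rw [four_mul_l₂, ← sepCard₂_mul_left σ]
  simp

lemma l₁_inv {n : ℕ} (σ : Hyperoctahedral n) : l₁ σ⁻¹ = l₁ σ := by
  have h1 := l₁_inv_mul σ 1
  have h2 := two_mul_l₁ σ
  have h3 : sepCard₁ σ 1 = sepCard₁ 1 σ := by
    unfold sepCard₁
    congr 1
    ext a
    simp only [Finset.mem_filter]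
    unfold sep₁
    tauto
  rw [mul_one] at h1
  omega

lemma l₂_inv {n : ℕ} (σ : Hyperoctahedral n) : l₂ σ⁻¹ = l₂ σ := by
  have h1 := l₂_inv_mul σ 1
  have h2 := four_mul_l₂ σ
  have h3 : sepCard₂ σ 1 = sepCard₂ 1 σ := by
    unfold sepCard₂
    congr 1
    ext p
    simp only [Finset.mem_filter]
    unfold sep₂
    tauto
  rw [mul_one] at h1
  omega

lemma posSemidef_prod {X I : Type*} [Fintype X] (s : Finset I) (M : I → Matrix X X ℂ)
    (hM : ∀ i ∈ s, (M i).PosSemidef) :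
    (Matrix.of fun x y => ∏ i ∈ s, M i x y).PosSemidef := by
  classical
  induction s using Finset.induction_on with
  | empty =>
    convert Matrix.posSemidef_vecMulVec_self_star (fun _ : X => (1 : ℂ)) using 1
    ext x y
    simp [Matrix.vecMulVec]
  | insert a s ha ih =>
    have h1 := (hM a (Finset.mem_insert_self a s)).hadamard
      (ih fun i hi => hM i (Finset.mem_insert_of_mem hi))
    have e : (Matrix.of fun x y => ∏ i ∈ insert a s, M i x y) =
        (M a).hadamard (Matrix.of fun x y => ∏ i ∈ s, M i x y) := by
      ext x y
      simp [Finset.prod_insert ha]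
    rw [e]
    exact h1

open Classical in
lemma posSemidef_ite {X : Type*} [Fintype X] (P : X → Prop) (c : ℝ) (hc : |c| ≤ 1) :
    (Matrix.of fun x y => if ¬ (P x ↔ P y) then (c : ℂ) else 1).PosSemidef := by
  obtain ⟨h1, h2⟩ := abs_le.1 hc
  have e1 := (Matrix.posSemidef_vecMulVec_self_star (fun _ : X => (1 : ℂ))).smul
    (show (0 : ℝ) ≤ (1 + c) / 2 by linarith)
  have e2 := (Matrix.posSemidef_vecMulVec_self_star
    (fun x : X => if P x then (1 : ℂ) else -1)).smul (show (0 : ℝ) ≤ (1 - c) / 2 by linarith)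
  convert e1.add e2 using 1
  ext x y
  by_cases hx : P x <;> by_cases hy : P y <;> simp [Matrix.vecMulVec, hx, hy] <;> ring

/-- The weight of `σ` in the type B symmetrization. -/
noncomputable def weight {n : ℕ} (α q : ℝ) (σ : Hyperoctahedral n) : ℝ := α ^ l₁ σ * q ^ l₂ σ

lemma weight_inv {n : ℕ} (α q : ℝ) (σ : Hyperoctahedral n) : weight α q σ⁻¹ = weight α q σ := by
  simp [weight, l₁_inv, l₂_inv]

open Classical in
lemma weight_eq {n : ℕ} (α q : ℝ) (σ τ : Hyperoctahedral n) : weight α q (σ⁻¹ * τ) =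
    (∏ k : Fin n, if sep₁ σ τ (k, 1) then α else 1) *
    ∏ p ∈ (Finset.univ : Finset (Fin n × Fin n × ℤˣ)).filter (fun p => p.1 < p.2.1),
      if sep₂ σ τ (p.1, 1) p.2 then q else 1 := by
  have h1 := l₁_inv_mul σ τ
  have h2 := l₂_inv_mul σ τ
  rw [sepCard₁_eq] at h1
  rw [sepCard₂_eq] at h2
  have h1' : l₁ (σ⁻¹ * τ) = ∑ k : Fin n, if sep₁ σ τ (k, 1) then 1 else 0 := by omega
  have h2' : l₂ (σ⁻¹ * τ) = ∑ p : Fin n × Fin n × ℤˣ,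
      if p.1 < p.2.1 ∧ sep₂ σ τ (p.1, 1) p.2 then 1 else 0 := by omega
  rw [weight, h1', h2', ← Finset.prod_pow_eq_pow_sum, ← Finset.prod_pow_eq_pow_sum,
    Finset.prod_filter]
  congr 1
  · refine Finset.prod_congr rfl fun k _ => ?_
    split_ifs <;> simp
  · refine Finset.prod_congr rfl fun k _ => ?_
    by_cases h : k.1 < k.2.1 <;> by_cases h' : sep₂ σ τ (k.1, 1) k.2 <;> simp [h, h']

lemma posSemidef_weight {X : Type*} [Fintype X] {n : ℕ} (s : X → Hyperoctahedral n) (α q : ℝ)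
    (hα : |α| ≤ 1) (hq : |q| ≤ 1) :
    (Matrix.of fun x y => (weight α q ((s x)⁻¹ * s y) : ℂ)).PosSemidef := by
  classical
  have h1 := posSemidef_prod (Finset.univ : Finset (Fin n)) _ fun k _ =>
    posSemidef_ite (fun x : X =>
      ((((s x)⁻¹ : Hyperoctahedral n) : Equiv.Perm (SignedIndex n)) (k, 1)).2 = 1) α hα
  have h2 := posSemidef_prod ((Finset.univ : Finset (Fin n × Fin n × ℤˣ)).filter
    (fun p => p.1 < p.2.1)) _ fun p _ => posSemidef_ite (fun x : X =>
      ((((s x)⁻¹ : Hyperoctahedral n) : Equiv.Perm (SignedIndex n)) (p.1, 1)).val <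
      ((((s x)⁻¹ : Hyperoctahedral n) : Equiv.Perm (SignedIndex n)) p.2).val) q hq
  have h3 := h1.hadamard h2
  refine Eq.mp (congrArg Matrix.PosSemidef ?_) h3
  ext x y
  simp only [Matrix.of_apply, Matrix.hadamard_apply, weight_eq]
  push_cast
  congr 1
  · refine Finset.prod_congr rfl fun k _ => ?_
    have e : ∀ a b : ℤˣ, ¬ (a = 1 ↔ b = 1) ↔ ¬ a = b := by decide
    by_cases h : sep₁ (s x) (s y) (k, 1)
    · rw [if_pos h]
      exact if_pos ((e _ _).2 h)
    · rw [if_neg h, Complex.ofReal_one]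
      exact if_neg fun h' => h ((e _ _).1 h')
  · refine Finset.prod_congr rfl fun p _ => ?_
    by_cases h : sep₂ (s x) (s y) (p.1, 1) p.2
    · rw [if_pos h]
      exact if_pos h
    · rw [if_neg h, Complex.ofReal_one]
      exact if_neg h

/-! ### The complexification of a real Hilbert space -/

/-- The complexification of `E`; the pair `⟨x, y⟩` stands for `x + i y`. -/
@[ext]
structure Complexification (E : Type*) where
  re : E
  im : E

namespace Complexification

variable {E : Type*} [NormedAddCommGroup E] [InnerProductSpace ℝ E]

instance : Zero (Complexification E) := ⟨⟨0, 0⟩⟩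
instance : Add (Complexification E) := ⟨fun z w => ⟨z.re + w.re, z.im + w.im⟩⟩
instance : Neg (Complexification E) := ⟨fun z => ⟨-z.re, -z.im⟩⟩

noncomputable instance : SMul ℂ (Complexification E) :=
  ⟨fun c z => ⟨c.re • z.re - c.im • z.im, c.re • z.im + c.im • z.re⟩⟩

@[simp] lemma zero_re : (0 : Complexification E).re = 0 := rfl
@[simp] lemma zero_im : (0 : Complexification E).im = 0 := rfl
@[simp] lemma add_re (z w : Complexification E) : (z + w).re = z.re + w.re := rfl
@[simp] lemma add_im (z w : Complexification E) : (z + w).im = z.im + w.im := rfl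
@[simp] lemma neg_re (z : Complexification E) : (-z).re = -z.re := rfl
@[simp] lemma neg_im (z : Complexification E) : (-z).im = -z.im := rfl
@[simp] lemma smul_re (c : ℂ) (z : Complexification E) :
    (c • z).re = c.re • z.re - c.im • z.im := rfl
@[simp] lemma smul_im (c : ℂ) (z : Complexification E) :
    (c • z).im = c.re • z.im + c.im • z.re := rfl

instance : AddCommGroup (Complexification E) where
  add_assoc _ _ _ := by ext <;> simp [add_assoc]
  zero_add _ := by ext <;> simp
  add_zero _ := by ext <;> simp
  add_comm _ _ := by ext <;> simp [add_comm]
  neg_add_cancel _ := by ext <;> simp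
  nsmul := nsmulRec
  zsmul := zsmulRec

noncomputable instance : Module ℂ (Complexification E) where
  one_smul _ := by ext <;> simp
  mul_smul _ _ _ := by ext <;> simp <;> module
  smul_zero _ := by ext <;> simp
  smul_add _ _ _ := by ext <;> simp <;> module
  add_smul _ _ _ := by ext <;> simp <;> module
  zero_smul _ := by ext <;> simp

/-- `⟨a + i b, c + i d⟩ = ⟨a, c⟩ + ⟨b, d⟩ + i (⟨a, d⟩ - ⟨b, c⟩)`. -/
@[reducible]
noncomputable def core : InnerProductSpace.Core ℂ (Complexification E) where
  inner z w := ⟨inner ℝ z.re w.re + inner ℝ z.im w.im, inner ℝ z.re w.im - inner ℝ z.im w.re⟩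
  conj_inner_symm z w := by
    apply Complex.ext <;> simp [real_inner_comm]
  re_inner_nonneg z := by
    simpa using add_nonneg (real_inner_self_nonneg (x := z.re)) (real_inner_self_nonneg (x := z.im))
  add_left z w v := by
    apply Complex.ext <;> simp [inner_add_left] <;> ring
  smul_left z w c := by
    apply Complex.ext <;>
      simp [inner_add_left, inner_sub_left, real_inner_smul_left] <;> ring
  definite z h := by
    have h1 := congrArg Complex.re h
    simp only [real_inner_self_eq_norm_sq, Complex.zero_re] at h1
    have h2 : ‖z.re‖ = 0 := by nlinarith [sq_nonneg ‖z.re‖, sq_nonneg ‖z.im‖]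
    have h3 : ‖z.im‖ = 0 := by nlinarith [sq_nonneg ‖z.re‖, sq_nonneg ‖z.im‖]
    ext
    · simpa using h2
    · simpa using h3

noncomputable instance : NormedAddCommGroup (Complexification E) :=
  @InnerProductSpace.Core.toNormedAddCommGroup ℂ _ _ _ _ core

noncomputable instance : InnerProductSpace ℂ (Complexification E) :=
  InnerProductSpace.ofCore core.toCore

/-- The embedding of the real Hilbert space in its complexification. -/
def ofReal (x : E) : Complexification E := ⟨x, 0⟩

lemma inner_def (z w : Complexification E) : inner ℂ z w =
    ⟨inner ℝ z.re w.re + inner ℝ z.im w.im, inner ℝ z.re w.im - inner ℝ z.im w.re⟩ := rfl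

lemma inner_ofReal (x y : E) : inner ℂ (ofReal x) (ofReal y) = ((inner ℝ x y : ℝ) : ℂ) := by
  apply Complex.ext <;> simp [inner_def, ofReal]

end Complexification

/-! ### The `(α, q)`-Fock space -/

section Fock

variable {H : Type*} [NormedAddCommGroup H] [InnerProductSpace ℂ H]

/-- A self-adjoint (complex linear) involution `x ↦ x̄` of `H`. -/
structure SelfAdjointInvolution (H : Type*) [NormedAddCommGroup H] [InnerProductSpace ℂ H] where
  toLinearMap : H →ₗ[ℂ] H
  involutive : Function.Involutive toLinearMap
  symmetric : toLinearMap.IsSymmetric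

/-- `x` or `x̄`, according to the sign. -/
def SelfAdjointInvolution.sign (J : SelfAdjointInvolution H) (s : ℤˣ) : H →ₗ[ℂ] H :=
  if s = 1 then LinearMap.id else J.toLinearMap

lemma SelfAdjointInvolution.inner_sign (J : SelfAdjointInvolution H) (s t : ℤˣ) (x y : H) :
    inner ℂ (J.sign s x) (J.sign t y) = inner ℂ x (J.sign (s * t) y) := by
  have h1 := J.symmetric x
  have h2 := J.involutive
  rcases Int.units_eq_one_or s with rfl | rfl <;>
    rcases Int.units_eq_one_or t with rfl | rfl <;> simp [sign, h1, h2 _]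

lemma SelfAdjointInvolution.sign_sign (J : SelfAdjointInvolution H) (s t : ℤˣ) (x : H) :
    J.sign s (J.sign t x) = J.sign (s * t) x := by
  have h2 := J.involutive
  rcases Int.units_eq_one_or s with rfl | rfl <;>
    rcases Int.units_eq_one_or t with rfl | rfl <;> simp [sign, h2 _]

lemma hyp_apply {n : ℕ} (σ : Hyperoctahedral n) (k : Fin n) (s : ℤˣ) :
    (σ : Equiv.Perm (SignedIndex n)) (k, s) =
      (((σ : Equiv.Perm (SignedIndex n)) (k, 1)).1,
        s * ((σ : Equiv.Perm (SignedIndex n)) (k, 1)).2) := by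
  rcases Int.units_eq_one_or s with rfl | rfl
  · simp
  · have := hyp_opp σ (k, 1)
    simpa [SignedIndex.opp] using this

/-- The permutation `k ↦ |σ k|` of the positions. -/
def absPerm {n : ℕ} (σ : Hyperoctahedral n) : Equiv.Perm (Fin n) where
  toFun k := ((σ : Equiv.Perm (SignedIndex n)) (k, 1)).1
  invFun k := (((σ⁻¹ : Hyperoctahedral n) : Equiv.Perm (SignedIndex n)) (k, 1)).1
  left_inv k := by
    have := (hyp_fst_eq σ⁻¹ (((σ : Equiv.Perm (SignedIndex n)) (k, 1)).1, 1)
      ((σ : Equiv.Perm (SignedIndex n)) (k, 1))).2 rfl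
    refine Eq.trans this ?_
    simp
  right_inv k := by
    have := (hyp_fst_eq σ ((((σ⁻¹ : Hyperoctahedral n) : Equiv.Perm (SignedIndex n)) (k, 1)).1, 1)
      (((σ⁻¹ : Hyperoctahedral n) : Equiv.Perm (SignedIndex n)) (k, 1))).2 rfl
    refine Eq.trans this ?_
    simp

/-- The action of `σ` on a family `x₁, …, x_n`: the vector `x_k` moves to the position `|σ k|`,
and is replaced by `x̄_k` if `σ k` is negative. -/
def actFun (J : SelfAdjointInvolution H) {n : ℕ} (σ : Hyperoctahedral n) (x : Fin n → H) :
    Fin n → H := fun j =>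
  J.sign (((σ⁻¹ : Hyperoctahedral n) : Equiv.Perm (SignedIndex n)) (j, 1)).2
    (x (((σ⁻¹ : Hyperoctahedral n) : Equiv.Perm (SignedIndex n)) (j, 1)).1)

/-- The action of the Coxeter group on `H^{⊗ n}`. -/
noncomputable def act (J : SelfAdjointInvolution H) {n : ℕ} (σ : Hyperoctahedral n) :
    (⨂[ℂ]^n H) →ₗ[ℂ] ⨂[ℂ]^n H :=
  PiTensorProduct.map (fun j : Fin n =>
      J.sign (((σ⁻¹ : Hyperoctahedral n) : Equiv.Perm (SignedIndex n)) (j, 1)).2) ∘ₗ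
    (PiTensorProduct.reindex ℂ (fun _ : Fin n => H) (absPerm σ)).toLinearMap

lemma act_tprod (J : SelfAdjointInvolution H) {n : ℕ} (σ : Hyperoctahedral n) (x : Fin n → H) :
    act J σ (PiTensorProduct.tprod ℂ x) = PiTensorProduct.tprod ℂ (actFun J σ x) := by
  have h1 := PiTensorProduct.reindex_tprod (R := ℂ) (s := fun _ : Fin n => H) (absPerm σ) x
  have h2 := PiTensorProduct.map_tprod (R := ℂ) (fun j : Fin n =>
    J.sign (((σ⁻¹ : Hyperoctahedral n) : Equiv.Perm (SignedIndex n)) (j, 1)).2)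
    (fun j => x ((absPerm σ).symm j))
  exact (congrArg _ h1).trans h2

lemma actFun_one (J : SelfAdjointInvolution H) {n : ℕ} (x : Fin n → H) : actFun J 1 x = x := by
  ext j
  simp [actFun, SelfAdjointInvolution.sign]

lemma actFun_mul (J : SelfAdjointInvolution H) {n : ℕ} (σ τ : Hyperoctahedral n)
    (x : Fin n → H) : actFun J (σ * τ) x = actFun J σ (actFun J τ x) := by
  ext j
  simp only [actFun, J.sign_sign]
  have : ((((σ * τ)⁻¹ : Hyperoctahedral n) : Equiv.Perm (SignedIndex n)) (j, 1)) =
      ((τ⁻¹ : Hyperoctahedral n) : Equiv.Perm (SignedIndex n))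
        (((σ⁻¹ : Hyperoctahedral n) : Equiv.Perm (SignedIndex n)) (j, 1)) := by
    simp [mul_inv_rev]
  rw [this]
  generalize ((σ⁻¹ : Hyperoctahedral n) : Equiv.Perm (SignedIndex n)) (j, 1) = a
  rw [hyp_apply τ⁻¹ a.1 a.2]

/-- `π₀ (x₁ ⊗ ⋯ ⊗ x_n) = x̄₁ ⊗ x₂ ⊗ ⋯ ⊗ x_n`. -/
lemma act_simpleReflection_zero (J : SelfAdjointInvolution H) {n : ℕ} (i : Fin n)
    (hi : (i : ℕ) = 0) (x : Fin n → H) :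
    act J (simpleReflection i) (PiTensorProduct.tprod ℂ x) =
      PiTensorProduct.tprod ℂ (Function.update x i (J.toLinearMap (x i))) := by
  rw [act_tprod]
  congr 1
  ext j
  simp only [actFun, simpleReflection_inv, simpleReflection_zero_apply i hi]
  by_cases h : j = i
  · subst h
    simp [SignedIndex.opp, SelfAdjointInvolution.sign]
  · simp [h, SelfAdjointInvolution.sign]

/-- `π_i (x₁ ⊗ ⋯ ⊗ x_n) = x₁ ⊗ ⋯ ⊗ x_{i+1} ⊗ x_i ⊗ ⋯ ⊗ x_n`. -/
lemma act_simpleReflection_pos (J : SelfAdjointInvolution H) {n : ℕ} (i j : Fin n)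
    (hj : (j : ℕ) + 1 = i) (x : Fin n → H) :
    act J (simpleReflection i) (PiTensorProduct.tprod ℂ x) =
      PiTensorProduct.tprod ℂ (x ∘ Equiv.swap j i) := by
  rw [act_tprod]
  congr 1
  ext k
  have hj' : (⟨(i : ℕ) - 1, by omega⟩ : Fin n) = j := Fin.ext (by simp; omega)
  simp [actFun, simpleReflection_inv, simpleReflection_pos_apply i (show (i : ℕ) ≠ 0 by omega),
    SelfAdjointInvolution.sign, hj']

/-- The functional `y₁ ⊗ ⋯ ⊗ y_n ↦ ∏ ⟨x_i, y_i⟩`. -/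
noncomputable def tensorInnerAux {n : ℕ} (x : Fin n → H) : (⨂[ℂ]^n H) →ₗ[ℂ] ℂ :=
  PiTensorProduct.lift ((MultilinearMap.mkPiAlgebra ℂ (Fin n) ℂ).compLinearMap
    fun i => innerₛₗ ℂ (x i))

lemma tensorInnerAux_tprod {n : ℕ} (x y : Fin n → H) :
    tensorInnerAux x (PiTensorProduct.tprod ℂ y) = ∏ i, inner ℂ (x i) (y i) := by
  simp [tensorInnerAux]

lemma tensor_hom_ext {n : ℕ} {f g : (⨂[ℂ]^n H) →ₗ[ℂ] ℂ}
    (h : ∀ y : Fin n → H, f (PiTensorProduct.tprod ℂ y) = g (PiTensorProduct.tprod ℂ y)) :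
    f = g :=
  PiTensorProduct.ext (MultilinearMap.ext h)

/-- The undeformed inner product on `H^{⊗ n}`:
`⟨x₁ ⊗ ⋯ ⊗ x_n, y₁ ⊗ ⋯ ⊗ y_n⟩ = ∏ ⟨x_i, y_i⟩`. -/
noncomputable def tensorInner (n : ℕ) : (⨂[ℂ]^n H) →+ ((⨂[ℂ]^n H) →ₗ[ℂ] ℂ) :=
  PiTensorProduct.liftAddHom
    (fun p : ℂ × (Fin n → H) => (starRingEnd ℂ) p.1 • tensorInnerAux p.2)
    (by
      intro r f i hf
      rw [show tensorInnerAux f = 0 from tensor_hom_ext fun y => by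
        rw [tensorInnerAux_tprod, Finset.prod_eq_zero (Finset.mem_univ i) (by simp [hf])]
        rfl, smul_zero])
    (by simp)
    (by
      intro _ r f i m₁ m₂
      rw [← smul_add]
      congr 1
      refine tensor_hom_ext fun y => ?_
      have e : ∀ m : H, ∏ j, inner ℂ (Function.update f i m j) (y j) =
          inner ℂ m (y i) * ∏ j ∈ {i}ᶜ, inner ℂ (f j) (y j) := by
        intro m
        rw [Fintype.prod_eq_mul_prod_compl i, Function.update_self]
        congr 1
        refine Finset.prod_congr rfl fun j hj => ?_
        rw [Function.update_of_ne (by simpa using hj)]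
      simp only [LinearMap.add_apply, tensorInnerAux_tprod, e, inner_add_left, add_mul])
    (by
      intro r r' f
      rw [← add_smul, map_add])
    (by
      intro _ r f i r'
      refine tensor_hom_ext fun y => ?_
      simp only [LinearMap.smul_apply, tensorInnerAux_tprod,
        Fintype.prod_eq_mul_prod_compl i, Function.update_self, inner_smul_left]
      rw [Finset.prod_congr rfl (g := fun j => inner ℂ (f j) (y j))]
      · simp only [map_mul, smul_eq_mul]
        ring
      · intro j hj
        rw [Function.update_of_ne (by simpa using hj)])

lemma tensorInner_smul_tprod {n : ℕ} (c : ℂ) (x : Fin n → H) :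
    tensorInner n (c • PiTensorProduct.tprod ℂ x) = (starRingEnd ℂ) c • tensorInnerAux x := by
  rw [← PiTensorProduct.tprodCoeff_eq_smul_tprod]
  rfl

lemma tensorInner_tprod {n : ℕ} (x y : Fin n → H) :
    tensorInner n (PiTensorProduct.tprod ℂ x) (PiTensorProduct.tprod ℂ y) =
      ∏ i, inner ℂ (x i) (y i) := by
  have := tensorInner_smul_tprod (1 : ℂ) x
  rw [one_smul] at this
  simp [this, tensorInnerAux_tprod]

lemma tensorInner_smul {n : ℕ} (c : ℂ) (f : ⨂[ℂ]^n H) :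
    tensorInner n (c • f) = (starRingEnd ℂ) c • tensorInner n f := by
  induction f using PiTensorProduct.induction_on with
  | smul_tprod r x =>
    rw [smul_smul, tensorInner_smul_tprod, tensorInner_smul_tprod, smul_smul, map_mul]
  | add f g hf hg => rw [smul_add, map_add, map_add, hf, hg, smul_add]

noncomputable instance {n : ℕ} : Fintype (Hyperoctahedral n) := Fintype.ofFinite _

/-- The type B symmetrization operator `∑_σ α ^ l₁ σ q ^ l₂ σ σ` on `H^{⊗ n}`. -/
noncomputable def symmetrization (J : SelfAdjointInvolution H) (α q : ℝ) (n : ℕ) :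
    (⨂[ℂ]^n H) →ₗ[ℂ] ⨂[ℂ]^n H :=
  ∑ σ : Hyperoctahedral n, (weight α q σ : ℂ) • act J σ

/-- The deformed inner product on `H^{⊗ n}`. -/
noncomputable def levelInner (J : SelfAdjointInvolution H) (α q : ℝ) (n : ℕ)
    (f g : ⨂[ℂ]^n H) : ℂ :=
  tensorInner n f (symmetrization J α q n g)

lemma prod_inner_actFun (J : SelfAdjointInvolution H) {n : ℕ} (σ τ : Hyperoctahedral n)
    (x y : Fin n → H) : ∏ j, inner ℂ (actFun J σ x j) (actFun J τ y j) =
      ∏ j, inner ℂ (x j) (actFun J (σ⁻¹ * τ) y j) := by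
  rw [← Equiv.prod_comp (absPerm σ)]
  refine Finset.prod_congr rfl fun k _ => ?_
  have h1 : actFun J σ x (absPerm σ k) =
      J.sign ((σ : Equiv.Perm (SignedIndex n)) (k, 1)).2 (x k) := by
    have e := hyp_apply σ⁻¹ ((σ : Equiv.Perm (SignedIndex n)) (k, 1)).1
      ((σ : Equiv.Perm (SignedIndex n)) (k, 1)).2
    simp only [Prod.mk.eta, InvMemClass.coe_inv, Equiv.Perm.inv_def, Equiv.symm_apply_apply] at e
    have e1 := congrArg Prod.fst e
    have e2 := congrArg Prod.snd e
    simp only at e1 e2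
    simp only [actFun, absPerm, Equiv.coe_fn_mk, InvMemClass.coe_inv, Equiv.Perm.inv_def, ← e1]
    congr 2
    rcases Int.units_eq_one_or ((σ : Equiv.Perm (SignedIndex n)) (k, 1)).2 with h | h <;>
    · rw [h] at e2
      rw [h]
      rw [eq_comm] at e2
      first
      | exact (one_mul _).symm.trans e2
      | exact neg_eq_iff_eq_neg.1 ((neg_one_mul _).symm.trans e2)
  rw [h1]
  have h2 : actFun J (σ⁻¹ * τ) y k =
      J.sign ((σ : Equiv.Perm (SignedIndex n)) (k, 1)).2 (actFun J τ y (absPerm σ k)) := by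
    rw [actFun_mul]
    simp [actFun, absPerm]
  rw [h2]
  have := J.inner_sign ((σ : Equiv.Perm (SignedIndex n)) (k, 1)).2 1 (x k)
    (actFun J τ y (absPerm σ k))
  simpa [SelfAdjointInvolution.sign] using this

lemma levelInner_tprod (J : SelfAdjointInvolution H) (α q : ℝ) {n : ℕ} (x y : Fin n → H) :
    levelInner J α q n (PiTensorProduct.tprod ℂ x) (PiTensorProduct.tprod ℂ y) =
      ∑ σ : Hyperoctahedral n, (weight α q σ : ℂ) * ∏ j, inner ℂ (x j) (actFun J σ y j) := by
  simp [levelInner, symmetrization, act_tprod, tensorInner_tprod]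

lemma levelInner_add_left (J : SelfAdjointInvolution H) (α q : ℝ) {n : ℕ} (f g h : ⨂[ℂ]^n H) :
    levelInner J α q n (f + g) h = levelInner J α q n f h + levelInner J α q n g h := by
  simp [levelInner]

lemma levelInner_smul_left (J : SelfAdjointInvolution H) (α q : ℝ) {n : ℕ} (c : ℂ)
    (f g : ⨂[ℂ]^n H) :
    levelInner J α q n (c • f) g = (starRingEnd ℂ) c * levelInner J α q n f g := by
  simp [levelInner, tensorInner_smul]

lemma levelInner_add_right (J : SelfAdjointInvolution H) (α q : ℝ) {n : ℕ} (f g h : ⨂[ℂ]^n H) :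
    levelInner J α q n f (g + h) = levelInner J α q n f g + levelInner J α q n f h := by
  simp [levelInner]

lemma levelInner_smul_right (J : SelfAdjointInvolution H) (α q : ℝ) {n : ℕ} (c : ℂ)
    (f g : ⨂[ℂ]^n H) :
    levelInner J α q n f (c • g) = c * levelInner J α q n f g := by
  simp [levelInner]

lemma levelInner_conj (J : SelfAdjointInvolution H) (α q : ℝ) {n : ℕ} (f g : ⨂[ℂ]^n H) :
    (starRingEnd ℂ) (levelInner J α q n g f) = levelInner J α q n f g := by
  induction f using PiTensorProduct.induction_on with
  | add f f' hf hf' => rw [levelInner_add_left, levelInner_add_right, map_add, hf, hf']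
  | smul_tprod r x =>
  induction g using PiTensorProduct.induction_on with
  | add f f' hf hf' => rw [levelInner_add_left, levelInner_add_right, map_add, hf, hf']
  | smul_tprod s y =>
  simp only [levelInner_smul_left, levelInner_smul_right, map_mul, levelInner_tprod, map_sum,
    map_prod, inner_conj_symm, Complex.conj_conj, Complex.conj_ofReal]
  have : ∀ σ : Hyperoctahedral n, (weight α q σ : ℂ) * ∏ j, inner ℂ (actFun J σ x j) (y j) =
      (weight α q σ⁻¹ : ℂ) * ∏ j, inner ℂ (x j) (actFun J σ⁻¹ y j) := by
    intro σ
    have h := prod_inner_actFun J σ 1 x y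
    rw [actFun_one, mul_one] at h
    rw [h, weight_inv]
  rw [Finset.sum_congr rfl fun σ _ => this σ]
  have h2 := Equiv.sum_comp (Equiv.inv (Hyperoctahedral n))
    (fun σ => (weight α q σ : ℂ) * ∏ j, inner ℂ (x j) (actFun J σ y j))
  simp only [Equiv.inv_apply] at h2
  rw [h2]
  ring

lemma levelInner_self_nonneg (J : SelfAdjointInvolution H) {α q : ℝ} (hα : |α| ≤ 1)
    (hq : |q| ≤ 1) {n : ℕ} (f : ⨂[ℂ]^n H) : 0 ≤ (levelInner J α q n f f).re := by
  classical
  have hf : f ∈ Submodule.span ℂ (Set.range (PiTensorProduct.tprod ℂ : _ → ⨂[ℂ]^n H)) := by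
    rw [PiTensorProduct.span_tprod_eq_top]; trivial
  obtain ⟨m, c, g, hg⟩ := Submodule.mem_span_set'.1 hf
  choose x hx using fun i => (g i).2
  have hfx : f = ∑ i, c i • PiTensorProduct.tprod ℂ (x i) := by
    rw [← hg]
    exact Finset.sum_congr rfl fun i _ => by rw [hx]
  have hsl : ∀ (h : ⨂[ℂ]^n H), levelInner J α q n f h = ∑ i, (starRingEnd ℂ) (c i) *
      levelInner J α q n (PiTensorProduct.tprod ℂ (x i)) h := by
    intro h
    simp [hfx, levelInner, tensorInner_smul]
  have hsr : ∀ (h : ⨂[ℂ]^n H), levelInner J α q n h f = ∑ i, c i *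
      levelInner J α q n h (PiTensorProduct.tprod ℂ (x i)) := by
    intro h
    simp [hfx, levelInner]
  let X := Fin m × Hyperoctahedral n
  have hM := (posSemidef_weight (fun p : X => p.2) α q hα hq).hadamard
    (posSemidef_prod (Finset.univ : Finset (Fin n)) _ fun j _ =>
      Matrix.posSemidef_gram ℂ (fun p : X => actFun J p.2 (x p.1) j))
  have h0 := hM.dotProduct_mulVec_nonneg (fun p : X => c p.1)
  have key : dotProduct (star fun p : X => c p.1) (Matrix.mulVec ((Matrix.of fun p r : X =>
      (weight α q (p.2⁻¹ * r.2) : ℂ)).hadamard (Matrix.of fun p r : X => ∏ j,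
        Matrix.gram ℂ (fun p : X => actFun J p.2 (x p.1) j) p r)) fun p : X => c p.1) =
      (Fintype.card (Hyperoctahedral n) : ℂ) * levelInner J α q n f f := by
    rw [hsl]
    simp only [hsr, dotProduct, Matrix.mulVec, Matrix.hadamard_apply, Matrix.of_apply,
      Matrix.gram, Pi.star_apply, levelInner_tprod, X, Fintype.sum_prod_type]
    simp only [prod_inner_actFun]
    rw [Finset.mul_sum]
    refine Finset.sum_congr rfl fun i _ => ?_
    have : ∀ σ : Hyperoctahedral n, (star (c i) * ∑ k, ∑ τ : Hyperoctahedral n,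
        (weight α q (σ⁻¹ * τ) : ℂ) * (∏ j, inner ℂ (x i j) (actFun J (σ⁻¹ * τ) (x k) j)) * c k) =
        (starRingEnd ℂ) (c i) * ∑ k, c k * ∑ τ : Hyperoctahedral n, (weight α q τ : ℂ) *
          ∏ j, inner ℂ (x i j) (actFun J τ (x k) j) := by
      intro σ
      congr 1
      refine Finset.sum_congr rfl fun k _ => ?_
      rw [Finset.mul_sum]
      rw [← Equiv.sum_comp (Equiv.mulLeft σ⁻¹) (fun τ => c k * ((weight α q τ : ℂ) *
          ∏ j, inner ℂ (x i j) (actFun J τ (x k) j)))]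
      refine Finset.sum_congr rfl fun τ _ => ?_
      simp only [Equiv.coe_mulLeft]
      ring
    rw [Finset.sum_congr rfl fun σ _ => this σ]
    simp
  have h1 : 0 ≤ (Fintype.card (Hyperoctahedral n) : ℂ) * levelInner J α q n f f := by
    rw [← key]
    exact h0
  have h2 := (Complex.le_def.1 h1).1
  rw [Complex.zero_re, ← Complex.ofReal_natCast, Complex.re_ofReal_mul] at h2
  have h3 : (0 : ℝ) < Fintype.card (Hyperoctahedral n) := by exact_mod_cast Fintype.card_pos
  exact nonneg_of_mul_nonneg_right h2 h3

/-- The algebraic full Fock space `⨁ H^{⊗ n}`, to be equipped with the deformed inner product. -/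
def FockSpace (_J : SelfAdjointInvolution H) {α q : ℝ} (_hα : α ∈ Set.Ioo (-1 : ℝ) 1)
    (_hq : q ∈ Set.Ioo (-1 : ℝ) 1) : Type _ :=
  DirectSum ℕ fun n => ⨂[ℂ]^n H

namespace FockSpace

variable (J : SelfAdjointInvolution H) {α q : ℝ} (hα : α ∈ Set.Ioo (-1 : ℝ) 1)
  (hq : q ∈ Set.Ioo (-1 : ℝ) 1)

noncomputable instance : AddCommGroup (FockSpace J hα hq) :=
  inferInstanceAs (AddCommGroup (DirectSum ℕ fun n => ⨂[ℂ]^n H))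

noncomputable instance : Module ℂ (FockSpace J hα hq) :=
  inferInstanceAs (Module ℂ (DirectSum ℕ fun n => ⨂[ℂ]^n H))

variable {J hα hq} in
/-- The component of `f` in `H^{⊗ n}`. -/
def component (f : FockSpace J hα hq) (n : ℕ) : ⨂[ℂ]^n H := DFinsupp.toFun f n

/-- The inclusion of `H^{⊗ n}` in the Fock space. -/
noncomputable def incl (n : ℕ) : (⨂[ℂ]^n H) →ₗ[ℂ] FockSpace J hα hq :=
  DirectSum.lof ℂ ℕ (fun n => ⨂[ℂ]^n H) n

variable {J hα hq} in
/-- The deformed inner product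
`⟨f, g⟩_{α,q} = ∑_n ⟨f_n, P_n g_n⟩`, where all but finitely many summands are zero. -/
noncomputable def deformedInner (f g : FockSpace J hα hq) : ℂ :=
  ∑ᶠ n, levelInner J α q n (f.component n) (g.component n)

variable {J hα hq} in
lemma component_add (f g : FockSpace J hα hq) (n : ℕ) :
    (f + g).component n = f.component n + g.component n := rfl

variable {J hα hq} in
lemma component_smul (c : ℂ) (f : FockSpace J hα hq) (n : ℕ) :
    (c • f).component n = c • f.component n := rfl

variable {J hα hq} in
lemma finite_support (f g : FockSpace J hα hq) :
    (Function.support fun n => levelInner J α q n (f.component n) (g.component n)).Finite := by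
  classical
  refine (DFinsupp.finite_support f).subset fun n hn => ?_
  simp only [Function.mem_support, Set.mem_ofPred_eq] at hn ⊢
  intro h
  apply hn
  have : f.component n = 0 := h
  simp [this, levelInner]

/-- The deformed form is a (semi-)inner product. -/
@[reducible]
noncomputable def core : PreInnerProductSpace.Core ℂ (FockSpace J hα hq) where
  inner := deformedInner
  conj_inner_symm f g := by
    simp only [deformedInner]
    refine (AddMonoidHom.map_finsum (starRingEnd ℂ : ℂ →+* ℂ).toAddMonoidHom
      (finite_support g f)).trans ?_
    exact finsum_congr fun n => levelInner_conj J α q _ _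
  re_inner_nonneg f := by
    simp only [deformedInner]
    have h := AddMonoidHom.map_finsum Complex.reAddGroupHom (finite_support f f)
    refine le_of_le_of_eq ?_ h.symm
    exact finsum_nonneg fun n => levelInner_self_nonneg J
      (abs_le.2 ⟨hα.1.le, hα.2.le⟩) (abs_le.2 ⟨hq.1.le, hq.2.le⟩) _
  add_left f g h := by
    simp only [deformedInner, component_add, levelInner_add_left]
    exact finsum_add_distrib (finite_support f h) (finite_support g h)
  smul_left f g c := by
    simp only [deformedInner, component_smul, levelInner_smul_left]
    exact (mul_finsum _ _).symm

noncomputable instance : SeminormedAddCommGroup (FockSpace J hα hq) :=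
  @InnerProductSpace.Core.toSeminormedAddCommGroup ℂ _ _ _ _ (core J hα hq)

noncomputable instance : InnerProductSpace ℂ (FockSpace J hα hq) :=
  InnerProductSpace.ofCore (core J hα hq)

lemma inner_def (f g : FockSpace J hα hq) : inner ℂ f g = deformedInner f g := rfl

/-- The vacuum vector `Ω`, spanning `H^{⊗ 0} = ℂ Ω`. -/
noncomputable def vacuum : FockSpace J hα hq :=
  incl J hα hq 0 (PiTensorProduct.tprod ℂ Fin.elim0)

/-- The right creation operator `x₁ ⊗ ⋯ ⊗ x_n ↦ x₁ ⊗ ⋯ ⊗ x_n ⊗ x` on the algebraic Fock space. -/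
noncomputable def creation (x : H) : FockSpace J hα hq →ₗ[ℂ] FockSpace J hα hq :=
  DirectSum.toModule ℂ ℕ _ fun n => incl J hα hq (n + 1) ∘ₗ
    ((TensorPower.mulEquiv (R := ℂ) (M := H) (n := n) (m := 1)).toLinearMap ∘ₗ
      (TensorProduct.mk ℂ (⨂[ℂ]^n H) (⨂[ℂ]^1 H)).flip (PiTensorProduct.tprod ℂ fun _ => x))

lemma creation_tprod (x : H) {n : ℕ} (v : Fin n → H) :
    creation J hα hq x (incl J hα hq n (PiTensorProduct.tprod ℂ v)) =
      incl J hα hq (n + 1) (PiTensorProduct.tprod ℂ (Fin.snoc v x : Fin (n + 1) → H)) := by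
  refine (DirectSum.toModule_lof ℂ n _).trans ?_
  have h := TensorPower.tprod_mul_tprod ℂ v (fun _ : Fin 1 => x)
  rw [TensorPower.gMul_def] at h
  rw [← Fin.append_right_eq_snoc v (fun _ : Fin 1 => x)]
  exact congrArg (incl J hα hq (n + 1)) h

/-- The completion of the Fock space. -/
abbrev Completed : Type _ := UniformSpace.Completion (FockSpace J hα hq)

/-- `C` is the bounded extension of the creation operator to the completion. -/
def IsCreation (x : H) (C : Completed J hα hq →L[ℂ] Completed J hα hq) : Prop :=
  ∀ f : FockSpace J hα hq, C f = (creation J hα hq x f : FockSpace J hα hq)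

/-- `G` is the Gaussian operator: the sum of the creation operator and
its adjoint, the annihilation operator. -/
def IsGaussian (x : H) (G : Completed J hα hq →L[ℂ] Completed J hα hq) : Prop :=
  ∃ C, IsCreation J hα hq x C ∧ G = ContinuousLinearMap.adjoint C + C

/-- The vacuum state. -/
noncomputable def vacuumState (T : Completed J hα hq →L[ℂ] Completed J hα hq) : ℂ :=
  inner ℂ (vacuum J hα hq : Completed J hα hq) (T (vacuum J hα hq : Completed J hα hq))

end FockSpace

end Fock

/-! ### von Neumann algebras and traces -/

/-- The von Neumann algebra generated by a set of bounded operators: the double commutant of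
the set together with its adjoints. -/
noncomputable def generatedVonNeumannAlgebra {K : Type*} [NormedAddCommGroup K]
    [InnerProductSpace ℂ K] [CompleteSpace K] (S : Set (K →L[ℂ] K)) : VonNeumannAlgebra K where
  toStarSubalgebra := StarSubalgebra.centralizer ℂ (StarSubalgebra.centralizer ℂ S : Set _)
  centralizer_centralizer' := by
    change Set.centralizer (Set.centralizer ((StarSubalgebra.centralizer ℂ
      (StarSubalgebra.centralizer ℂ S : Set (K →L[ℂ] K)) : StarSubalgebra ℂ (K →L[ℂ] K)) :
        Set (K →L[ℂ] K))) = _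
    rw [StarSubalgebra.coe_centralizer_centralizer ℂ S,
      Set.centralizer_centralizer_centralizer]
    exact (StarSubalgebra.coe_centralizer_centralizer ℂ S).symm

/-- A functional `φ` is a trace on the von Neumann algebra `A`. -/
def IsTraceOn {K : Type*} [NormedAddCommGroup K] [InnerProductSpace ℂ K] [CompleteSpace K]
    (A : VonNeumannAlgebra K) (φ : (K →L[ℂ] K) → ℂ) : Prop :=
  ∀ S ∈ A, ∀ T ∈ A, φ (S * T) = φ (T * S)

end TypeB

namespace TypeB

/-! ### Signed permutations -/

/-! Everything rests on an explicit annihilation operator. Write a signed permutation of `n + 1`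
positions as the image `k` (counted from 0) and sign `t` of the last position, together with a
signed permutation of the remaining `n`. The weight then factors, the new factor being `q ^ (n - k)`
for `t = 1` and `α * q ^ (n + k)` for `t = -1` (`weight_extend`). Hence the adjoint of `B*(u)` sends
`y₀ ⊗ ⋯ ⊗ y_n` to the sum over `k` of `q ^ (n - k) ⟨u, y_k⟩ + α q ^ (n + k) ⟨u, ȳ_k⟩` times the
tensor with `y_k` removed (`levelInner_snoc`, `inner_creation_left`).

Boundedness: these coefficients are summable in absolute value uniformly in `n`. So `T = B(u) B*(u)`
multiplies a crude size of a vector of bounded degree by at most a constant `C`, and the norm is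
dominated by that size up to a factor depending only on the degree. Thus the norms of `T ^ m f` grow
at most like `C ^ m`; since `T` is symmetric, this forces `‖T f‖ ≤ C ‖f‖`
(`norm_apply_le_of_isSymmetric`), so `B*(u)` is bounded by `√C`.

If `α ≠ 0`: let `a(x, y) = ⟨x, y⟩`, `b(x, y) = ⟨x, ȳ⟩` and `c = a + α b`. Traciality on second
moments makes `b` symmetric, and on fourth moments it gives `c(x, y) b(z, w) = c(x, w) b(y, z)`. As
the dimension is at least 2, there are nonzero `e`, `z` with `b(e, z) = 0`; since `c(e, e) ≠ 0`, the
vector `z̄` is orthogonal to all real vectors, hence zero, which is absurd for an involution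
(`not_isTraceOn_of_ne_zero`).

If `α = 0`: reversing the tensor factors is unitary, and conjugating by it turns the right Gaussian
operators into left ones. For real vectors left and right Gaussians commute, and they agree on `Ω`
(`leftGaussian_mul_gaussian`, `leftGaussian_vacuum`). So products of right Gaussians have partners
in the commutant with the same action on `Ω`, these products span a dense subspace when applied to
`Ω`, and this implies the trace property (`isTraceOn_of_dense_partnerSubmodule`). -/

/-- The element `(k, t) ↦ (π k, t * s k)` of the hyperoctahedral group. -/
def ofSignedPerm {n : ℕ} (p : Equiv.Perm (Fin n) × (Fin n → ℤˣ)) : Hyperoctahedral n :=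
  ⟨{ toFun := fun a => (p.1 a.1, a.2 * p.2 a.1)
     invFun := fun a => (p.1.symm a.1, a.2 * p.2 (p.1.symm a.1))
     left_inv := fun a => by simp [mul_assoc]
     right_inv := fun a => by simp [mul_assoc] },
   fun a => by simp [SignedIndex.opp]⟩

lemma ofSignedPerm_apply {n : ℕ} (p : Equiv.Perm (Fin n) × (Fin n → ℤˣ)) (k : Fin n) (t : ℤˣ) :
    (ofSignedPerm p : Equiv.Perm (SignedIndex n)) (k, t) = (p.1 k, t * p.2 k) := rfl

lemma ofSignedPerm_bijective {n : ℕ} :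
    Function.Bijective (ofSignedPerm : Equiv.Perm (Fin n) × (Fin n → ℤˣ) → Hyperoctahedral n) := by
  constructor
  · rintro ⟨π, s⟩ ⟨π', s'⟩ h
    have key : ∀ k, (π k, 1 * s k) = (π' k, 1 * s' k) := fun k =>
      congrArg (fun σ : Hyperoctahedral n => (σ : Equiv.Perm (SignedIndex n)) (k, 1)) h
    refine Prod.ext (Equiv.ext fun k => congrArg Prod.fst (key k)) (funext fun k => ?_)
    simpa using congrArg Prod.snd (key k)
  · intro σ
    refine ⟨(absPerm σ, fun k => ((σ : Equiv.Perm (SignedIndex n)) (k, 1)).2), ?_⟩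
    apply Subtype.ext
    ext1 ⟨k, t⟩
    rw [ofSignedPerm_apply, hyp_apply]
    rfl

/-- The contribution of a pair of values to the `q`-weight of a signed permutation. -/
noncomputable def pairWeight (q : ℝ) {n : ℕ} (a b : SignedIndex n) : ℝ :=
  (if b.val < a.val then q else 1) * if a.val + b.val < 0 then q else 1

/-- The weight is a product over the reflecting hyperplanes that separate `σ` from the identity. In
terms of the values of `σ`: `x_k = 0` separates when `σ k` is negative, `x_i = x_j` (with `i < j`)
when `σ j < σ i`, and `x_i = -x_j` when `σ i + σ j < 0`. -/
lemma weight_ofSignedPerm {n : ℕ} (α q : ℝ) (π : Equiv.Perm (Fin n)) (s : Fin n → ℤˣ) :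
    weight α q (ofSignedPerm (π, s)) = (∏ k, if s k = 1 then 1 else α) *
      ∏ j, ∏ i, if i < j then pairWeight q (π i, s i) (π j, s j) else 1 := by
  classical
  -- Separation is defined through inverses, so taking the inverse here makes the values of the
  -- signed permutation itself appear.
  have h := weight_eq α q (ofSignedPerm (π, s))⁻¹ 1
  rw [inv_inv, mul_one] at h
  rw [h]
  congr 1
  · refine Finset.prod_congr rfl fun k _ => ?_
    simp only [sep₁, inv_inv, ofSignedPerm_apply, one_mul, inv_one, Subgroup.coe_one,
      Equiv.Perm.one_apply]
    split_ifs <;> simp_all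
  · rw [Finset.prod_filter, Fintype.prod_prod_type, Finset.prod_comm' (t' := Finset.univ)
      (s' := fun _ => Finset.univ) (by simp), Fintype.prod_prod_type]
    refine Finset.prod_congr rfl fun j _ => ?_
    rw [Finset.prod_comm]
    refine Finset.prod_congr rfl fun i _ => ?_
    -- The two signs stand for the hyperplanes `x_i = x_j` and `x_i = -x_j`.
    rw [show (Finset.univ : Finset ℤˣ) = {1, -1} from rfl, Finset.prod_pair (by decide)]
    by_cases hij : i < j
    · have hne : π i ≠ π j := fun h => hij.ne (π.injective h)
      have h1 : SignedIndex.val (π i, s i) ≠ SignedIndex.val (π j, s j) := fun h =>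
        hne (congrArg Prod.fst (SignedIndex.val_injective h))
      have h2 : SignedIndex.val (π j, -s j) = - SignedIndex.val (π j, s j) :=
        SignedIndex.val_opp (π j, s j)
      have h3 : SignedIndex.val (π i, s i) ≠ SignedIndex.val (π j, -s j) := fun h =>
        hne (congrArg Prod.fst (SignedIndex.val_injective h))
      have hij' : (i : ℕ) < j := hij
      have e1 : SignedIndex.val (i, 1) < SignedIndex.val (j, 1) := by
        simp [SignedIndex.val, hij']
      have e2 : ¬ SignedIndex.val (i, 1) < SignedIndex.val (j, -1) := by
        simp [SignedIndex.val]; omega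
      simp only [hij, sep₂, inv_inv, ofSignedPerm_apply, one_mul, inv_one,
        Subgroup.coe_one, Equiv.Perm.one_apply, e1, e2, iff_true, iff_false, not_not, neg_mul,
        if_true, pairWeight]
      rw [h2] at *
      congr 1
      · exact if_congr (by omega) rfl rfl
      · exact if_congr (by omega) rfl rfl
    · simp [hij]

/-! ### Factoring the weight over the last position. -/

/-- Extend a permutation by `n ↦ k`. -/
def extendPerm {n : ℕ} (k : Fin (n + 1)) (π : Equiv.Perm (Fin n)) : Equiv.Perm (Fin (n + 1)) :=
  (finSuccEquivLast.trans (Equiv.optionCongr π)).trans (finSuccEquiv' k).symm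

@[simp] lemma extendPerm_last {n : ℕ} (k : Fin (n + 1)) (π : Equiv.Perm (Fin n)) :
    extendPerm k π (Fin.last n) = k := by simp [extendPerm]

@[simp] lemma extendPerm_castSucc {n : ℕ} (k : Fin (n + 1)) (π : Equiv.Perm (Fin n)) (i : Fin n) :
    extendPerm k π i.castSucc = k.succAbove (π i) := by simp [extendPerm]

lemma extendPerm_bijective {n : ℕ} : Function.Bijective
    fun p : Fin (n + 1) × Equiv.Perm (Fin n) => extendPerm p.1 p.2 := by
  rw [Fintype.bijective_iff_injective_and_card]
  constructor
  · rintro ⟨k, π⟩ ⟨l, ρ⟩ h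
    have h1 : ∀ i, extendPerm k π i = extendPerm l ρ i := fun i => congrArg (fun σ => σ i) h
    have h2 := h1 (Fin.last n)
    simp only [extendPerm_last] at h2
    subst h2
    refine Prod.ext rfl (Equiv.ext fun i => ?_)
    simpa using h1 i.castSucc
  · simp [Fintype.card_perm, Nat.factorial_succ]

/-- The coefficient with which the `k`-th of `n + 1` factors is annihilated. -/
noncomputable def removalWeight (α q : ℝ) {n : ℕ} (k : Fin (n + 1)) (t : ℤˣ) : ℝ :=
  if t = 1 then q ^ (n - (k : ℕ)) else α * q ^ (n + (k : ℕ))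

/-- Each of the two signs contributes at most a geometric series in `|q|`. The independence of `n`
is what later yields a single bound on all levels. -/
lemma sum_abs_removalWeight_le {α q : ℝ} (hα : α ∈ Set.Ioo (-1 : ℝ) 1)
    (hq : q ∈ Set.Ioo (-1 : ℝ) 1) (n : ℕ) :
    ∑ k : Fin (n + 1), ∑ t, |removalWeight α q k t| ≤ 2 / (1 - |q|) := by
  have hq' : |q| < 1 := abs_lt.2 hq
  have hα' : |α| ≤ 1 := (abs_lt.2 hα).le
  have hgeom : ∑ k : Fin (n + 1), |q| ^ (k : ℕ) ≤ (1 - |q|)⁻¹ := by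
    rw [← tsum_geometric_of_lt_one (abs_nonneg q) hq',
      Fin.sum_univ_eq_sum_range (fun k => |q| ^ k)]
    exact (summable_geometric_of_lt_one (abs_nonneg q) hq').sum_le_tsum _
      fun _ _ => by positivity
  have hs : (-1 : ℤˣ) ≠ 1 := by decide
  have h1 : ∑ k : Fin (n + 1), |q| ^ (n - (k : ℕ)) = ∑ k : Fin (n + 1), |q| ^ (k : ℕ) := by
    rw [← Equiv.sum_comp Fin.revPerm]
    refine Finset.sum_congr rfl fun k _ => ?_
    congr 1
    simp
    omega
  have h2 : ∑ k : Fin (n + 1), |α| * |q| ^ (n + (k : ℕ)) ≤ ∑ k : Fin (n + 1), |q| ^ (k : ℕ) := by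
    refine Finset.sum_le_sum fun k _ => ?_
    have h3 : |q| ^ (n + (k : ℕ)) ≤ |q| ^ (k : ℕ) :=
      pow_le_pow_of_le_one (abs_nonneg q) hq'.le (by omega)
    have h4 : 0 ≤ |q| ^ (n + (k : ℕ)) := by positivity
    nlinarith
  have e : ∀ k : Fin (n + 1), ∑ t, |removalWeight α q k t| =
      |q| ^ (n - (k : ℕ)) + |α| * |q| ^ (n + (k : ℕ)) := by
    intro k
    rw [show (Finset.univ : Finset ℤˣ) = {1, -1} from rfl, Finset.sum_pair (by decide)]
    simp [removalWeight, hs, abs_mul]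
  simp only [e]
  rw [Finset.sum_add_distrib, h1, div_eq_mul_inv]
  linarith

/-- Both conditions in `pairWeight` depend only on the signs and on the order of the absolute
values, which `succAbove` preserves. -/
lemma pairWeight_succAbove (q : ℝ) {n : ℕ} (k : Fin (n + 1)) (a b : Fin n) (s t : ℤˣ) :
    pairWeight q (k.succAbove a, s) (k.succAbove b, t) = pairWeight q (a, s) (b, t) := by
  have h : k.succAbove a < k.succAbove b ↔ a < b := k.strictMono_succAbove.lt_iff_lt
  have h' : k.succAbove b < k.succAbove a ↔ b < a := k.strictMono_succAbove.lt_iff_lt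
  rw [Fin.lt_def, Fin.lt_def] at h h'
  simp only [pairWeight]
  congr 1
  · refine if_congr ?_ rfl rfl
    rcases Int.units_eq_one_or s with rfl | rfl <;>
    rcases Int.units_eq_one_or t with rfl | rfl <;> simp [SignedIndex.val] <;> omega
  · refine if_congr ?_ rfl rfl
    rcases Int.units_eq_one_or s with rfl | rfl <;>
    rcases Int.units_eq_one_or t with rfl | rfl <;> simp [SignedIndex.val] <;> omega

/-- The result does not involve `s`: changing the sign of the other value only exchanges the roles
of the hyperplanes `x_i = x_j` and `x_i = -x_j`. This independence is what lets the weight factor.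
-/
lemma pairWeight_last (q : ℝ) {n : ℕ} (k : Fin (n + 1)) (a : Fin n) (s t : ℤˣ) :
    pairWeight q (k.succAbove a, s) (k, t) =
      if t = 1 then (if (k : ℕ) ≤ a then q else 1) else q * if (a : ℕ) < k then q else 1 := by
  have h : (k.succAbove a : ℕ) = if (a : ℕ) < k then (a : ℕ) else a + 1 := by
    simp only [Fin.succAbove, Fin.lt_def, Fin.val_castSucc]
    split_ifs <;> simp
  have hs : (-1 : ℤˣ) ≠ 1 := by decide
  simp only [pairWeight, SignedIndex.val, h]
  rcases Int.units_eq_one_or s with rfl | rfl <;>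
    rcases Int.units_eq_one_or t with rfl | rfl <;>
    simp only [Units.val_one, Units.val_neg, one_mul, neg_mul, if_true, hs, if_false] <;>
    split_ifs <;> first | omega | simp

lemma prod_ite_lt (q : ℝ) (n k : ℕ) (hk : k ≤ n) :
    ∏ a : Fin n, (if (a : ℕ) < k then q else 1) = q ^ k := by
  rw [Finset.prod_ite, Finset.prod_const_one, mul_one, Finset.prod_const,
    Fin.card_filter_val_lt, min_eq_right hk]

lemma prod_ite_le (q : ℝ) (n k : ℕ) :
    ∏ a : Fin n, (if k ≤ (a : ℕ) then q else 1) = q ^ (n - k) := by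
  rw [Finset.prod_ite, Finset.prod_const_one, mul_one, Finset.prod_const]
  congr 1
  have h := Finset.card_filter_add_card_filter_not (s := (Finset.univ : Finset (Fin n)))
    (fun a => (a : ℕ) < k)
  simp only [Fin.card_filter_val_lt, not_lt, Finset.card_univ, Fintype.card_fin] at h
  omega

/-- Pairs not involving the last position reproduce the smaller weight. Of the pairs that do, for `t
= 1` the `n - k` values with `a ≥ k` give a `q`; for `t = -1` all `n` give one, and the `k` values
with `a < k` give a second. -/
lemma weight_extend (α q : ℝ) {n : ℕ} (k : Fin (n + 1)) (t : ℤˣ) (π : Equiv.Perm (Fin n))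
    (s : Fin n → ℤˣ) :
    weight α q (ofSignedPerm (extendPerm k π, (Fin.snoc s t : Fin (n + 1) → ℤˣ))) =
      removalWeight α q k t * weight α q (ofSignedPerm (π, s)) := by
  simp only [weight_ofSignedPerm, Fin.prod_univ_castSucc, Fin.snoc_castSucc, Fin.snoc_last,
    extendPerm_castSucc, extendPerm_last, Fin.castSucc_lt_castSucc_iff, Fin.castSucc_lt_last,
    if_true, pairWeight_succAbove, lt_irrefl, if_false, mul_one, pairWeight_last,
    (Fin.castSucc_lt_last _).not_gt]
  rw [Equiv.prod_comp π (fun a : Fin n => if t = 1 then (if (k : ℕ) ≤ a then q else 1)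
    else q * if (a : ℕ) < k then q else 1), removalWeight]
  by_cases ht : t = 1
  · simp only [ht, if_true, prod_ite_le]
    ring
  · simp only [ht, if_false, Finset.prod_mul_distrib, Finset.prod_const, Finset.card_univ,
      Fintype.card_fin, prod_ite_lt q n k (Fin.is_le k)]
    ring

/-! ### Peeling one tensor factor off the deformed inner product. -/

section Level

variable {H : Type*} [NormedAddCommGroup H] [InnerProductSpace ℂ H]

/-- The sum over the group is reindexed by inversion, which preserves the weight and removes the
inverses from the action. -/
lemma levelInner_eq_sum_signedPerm (J : SelfAdjointInvolution H) (α q : ℝ) {n : ℕ}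
    (x y : Fin n → H) :
    levelInner J α q n (PiTensorProduct.tprod ℂ x) (PiTensorProduct.tprod ℂ y) =
      ∑ π : Equiv.Perm (Fin n), ∑ s : Fin n → ℤˣ, (weight α q (ofSignedPerm (π, s)) : ℂ) *
        ∏ j, inner ℂ (x j) (J.sign (s j) (y (π j))) := by
  rw [levelInner_tprod, ← Fintype.sum_prod_type' (f := fun π s =>
    (weight α q (ofSignedPerm (π, s)) : ℂ) * ∏ j, inner ℂ (x j) (J.sign (s j) (y (π j)))),
    ← Equiv.sum_comp (Equiv.inv (Hyperoctahedral n)),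
    ← (Equiv.ofBijective _ (ofSignedPerm_bijective (n := n))).sum_comp]
  refine Finset.sum_congr rfl fun p _ => ?_
  simp [weight_inv, actFun, ofSignedPerm_apply]

/-- Annihilation of the last factor of the left argument. -/
lemma levelInner_snoc (J : SelfAdjointInvolution H) (α q : ℝ) {n : ℕ}
    (x : Fin n → H) (u : H) (y : Fin (n + 1) → H) :
    levelInner J α q (n + 1) (PiTensorProduct.tprod ℂ (Fin.snoc x u : Fin (n + 1) → H))
        (PiTensorProduct.tprod ℂ y) =
      ∑ k, (∑ t, (removalWeight α q k t : ℂ) * inner ℂ u (J.sign t (y k))) *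
        levelInner J α q n (PiTensorProduct.tprod ℂ x)
          (PiTensorProduct.tprod ℂ (k.removeNth y)) := by
  -- Signed permutations are sorted by the image `k` and the sign `t` of the last position.
  rw [levelInner_eq_sum_signedPerm, ← (Equiv.ofBijective _ extendPerm_bijective).sum_comp,
    Fintype.sum_prod_type]
  refine Finset.sum_congr rfl fun k _ => ?_
  rw [levelInner_eq_sum_signedPerm, Finset.mul_sum]
  refine Finset.sum_congr rfl fun π _ => ?_
  rw [← (Fin.snocEquiv fun _ : Fin (n + 1) => ℤˣ).sum_comp, Fintype.sum_prod_type,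
    Finset.sum_mul]
  refine Finset.sum_congr rfl fun t _ => ?_
  rw [Finset.mul_sum]
  refine Finset.sum_congr rfl fun s _ => ?_
  rw [show (Fin.snocEquiv fun _ : Fin (n + 1) => ℤˣ) (t, s) = Fin.snoc s t from rfl]
  simp only [Equiv.ofBijective_apply, Fin.prod_univ_castSucc,
    Fin.snoc_castSucc, Fin.snoc_last, extendPerm_castSucc, extendPerm_last, weight_extend,
    Fin.removeNth_apply, Complex.ofReal_mul]
  ring

end Level

end TypeB

/-! ### The annihilation operator on the algebraic Fock space. -/

namespace TypeB

section

variable {H : Type*} [NormedAddCommGroup H] [InnerProductSpace ℂ H]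

namespace FockSpace

variable (J : SelfAdjointInvolution H) {α q : ℝ} (hα : α ∈ Set.Ioo (-1 : ℝ) 1)
  (hq : q ∈ Set.Ioo (-1 : ℝ) 1)

/-- The simple tensor `x₁ ⊗ ⋯ ⊗ x_n` in the Fock space. -/
noncomputable def pure {n : ℕ} (x : Fin n → H) : FockSpace J hα hq :=
  incl J hα hq n (PiTensorProduct.tprod ℂ x)

variable {J hα hq} in
@[elab_as_elim]
lemma induction_pure {p : FockSpace J hα hq → Prop} (f : FockSpace J hα hq)
    (pure : ∀ (n : ℕ) (x : Fin n → H), p (pure J hα hq x))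
    (smul : ∀ (c : ℂ) f, p f → p (c • f)) (add : ∀ f g, p f → p g → p (f + g)) : p f := by
  induction f using DirectSum.induction_on with
  | zero =>
    have := smul 0 _ (pure 0 Fin.elim0)
    rwa [zero_smul] at this
  | of n f =>
    change p (incl J hα hq n f)
    induction f using PiTensorProduct.induction_on with
    | smul_tprod r x =>
      rw [map_smul]
      exact smul _ _ (pure n x)
    | add f g hf hg =>
      rw [map_add]
      exact add _ _ hf hg
  | add f g hf hg => exact add _ _ hf hg

variable {J hα hq} in
lemma hom_ext {V : Type*} [AddCommGroup V] [Module ℂ V] {A B : FockSpace J hα hq →ₗ[ℂ] V}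
    (h : ∀ (n : ℕ) (x : Fin n → H), A (pure J hα hq x) = B (pure J hα hq x)) : A = B := by
  ext f
  induction f using induction_pure with
  | pure n x => exact h n x
  | smul c f hf => rw [map_smul, map_smul, hf]
  | add f g hf hg => rw [map_add, map_add, hf, hg]

lemma component_incl (n m : ℕ) (f : ⨂[ℂ]^n H) :
    (incl J hα hq n f).component m = if h : n = m then h ▸ f else 0 := by
  by_cases h : n = m
  · subst h
    exact (dif_pos rfl).symm ▸ DirectSum.of_eq_same (β := fun n => ⨂[ℂ]^n H) n f
  · rw [dif_neg h]
    exact DirectSum.of_eq_of_ne (β := fun n => ⨂[ℂ]^n H) n m f (Ne.symm h)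

lemma inner_incl (n : ℕ) (f g : ⨂[ℂ]^n H) :
    inner ℂ (incl J hα hq n f) (incl J hα hq n g) = levelInner J α q n f g := by
  rw [inner_def, deformedInner, finsum_eq_single _ n]
  · simp [component_incl]
  · intro m hm
    simp [component_incl, hm.symm, levelInner]

lemma inner_incl_of_ne {m n : ℕ} (hmn : m ≠ n) (f : ⨂[ℂ]^m H) (g : ⨂[ℂ]^n H) :
    inner ℂ (incl J hα hq m f) (incl J hα hq n g) = 0 := by
  rw [inner_def, deformedInner]
  refine finsum_eq_zero_of_forall_eq_zero fun k => ?_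
  by_cases h : m = k
  · have h' : ¬ n = k := fun h' => hmn (h.trans h'.symm)
    simp [component_incl, h', levelInner]
  · simp [component_incl, h, levelInner]

lemma inner_pure {n : ℕ} (x y : Fin n → H) : inner ℂ (pure J hα hq x) (pure J hα hq y) =
    levelInner J α q n (PiTensorProduct.tprod ℂ x) (PiTensorProduct.tprod ℂ y) :=
  inner_incl J hα hq n _ _

lemma inner_pure_of_ne {m n : ℕ} (hmn : m ≠ n) (x : Fin m → H) (y : Fin n → H) :
    inner ℂ (pure J hα hq x) (pure J hα hq y) = 0 :=
  inner_incl_of_ne J hα hq hmn _ _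

lemma creation_pure (u : H) {n : ℕ} (x : Fin n → H) : creation J hα hq u (pure J hα hq x) =
    pure J hα hq (Fin.snoc x u : Fin (n + 1) → H) := creation_tprod J hα hq u x

lemma vacuum_eq : vacuum J hα hq = pure J hα hq Fin.elim0 := rfl

/-- The functional `y ↦ q ^ (n - k) ⟨u, y⟩ + α q ^ (n + k) ⟨u, ȳ⟩`. -/
noncomputable def removalFunctional (α q : ℝ) (u : H) {n : ℕ} (k : Fin (n + 1)) : H →ₗ[ℂ] ℂ :=
  ∑ t, (removalWeight α q k t : ℂ) • (innerₛₗ ℂ u ∘ₗ J.sign t)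

/-- The annihilation operator on the algebraic Fock space. -/
noncomputable def annihilation (u : H) : FockSpace J hα hq →ₗ[ℂ] FockSpace J hα hq :=
  DirectSum.toModule ℂ ℕ _ fun
    | 0 => 0
    | n + 1 => incl J hα hq n ∘ₗ PiTensorProduct.lift (∑ k,
        ((removalFunctional J α q u k).smulRight
          (PiTensorProduct.tprod ℂ : MultilinearMap ℂ (fun _ : Fin n => H) _)).uncurryMid k)

lemma annihilation_pure_zero (u : H) (y : Fin 0 → H) :
    annihilation J hα hq u (pure J hα hq y) = 0 :=
  DirectSum.toModule_lof ℂ 0 _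

lemma annihilation_pure_succ (u : H) {n : ℕ} (y : Fin (n + 1) → H) :
    annihilation J hα hq u (pure J hα hq y) =
      ∑ k, removalFunctional J α q u k (y k) • pure J hα hq (k.removeNth y) := by
  refine (DirectSum.toModule_lof ℂ (n + 1) _).trans ?_
  simp [pure, LinearMap.uncurryMid]

/-- Adjointness already holds on the algebraic space, before boundedness is known: on simple tensors
of matching degree it is `levelInner_snoc`, and otherwise both sides vanish. -/
lemma inner_creation_left (u : H) (f g : FockSpace J hα hq) :
    inner ℂ (creation J hα hq u f) g = inner ℂ f (annihilation J hα hq u g) := by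
  induction f using induction_pure with
  | smul c f hf => simp only [map_smul, inner_smul_left, hf]
  | add f f' hf hf' => simp only [map_add, inner_add_left, hf, hf']
  | pure m x =>
  induction g using induction_pure with
  | smul c f hf => simp only [map_smul, inner_smul_right, hf]
  | add f f' hf hf' => simp only [map_add, inner_add_right, hf, hf']
  | pure n y =>
  rw [creation_pure]
  cases n with
  | zero => rw [annihilation_pure_zero, inner_zero_right, inner_pure_of_ne _ _ _ (by omega)]
  | succ n =>
    rw [annihilation_pure_succ, inner_sum]
    by_cases h : m = n
    · subst h
      rw [inner_pure, levelInner_snoc]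
      refine Finset.sum_congr rfl fun k _ => ?_
      rw [inner_smul_right, inner_pure]
      simp [removalFunctional]
    · rw [inner_pure_of_ne _ _ _ (by omega)]
      refine (Finset.sum_eq_zero fun k _ => ?_).symm
      rw [inner_smul_right, inner_pure_of_ne _ _ _ h, mul_zero]

lemma creation_add (u v : H) : creation J hα hq (u + v) = creation J hα hq u + creation J hα hq v := by
  refine hom_ext fun n x => ?_
  have h := (PiTensorProduct.tprod ℂ : MultilinearMap ℂ (fun _ : Fin (n + 1) => H) _).snoc_add x u v
  rw [LinearMap.add_apply, creation_pure, creation_pure, creation_pure]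
  exact (congrArg (incl J hα hq (n + 1)) h).trans (map_add _ _ _)

lemma creation_smul (c : ℂ) (u : H) : creation J hα hq (c • u) = c • creation J hα hq u := by
  refine hom_ext fun n x => ?_
  have h := (PiTensorProduct.tprod ℂ : MultilinearMap ℂ (fun _ : Fin (n + 1) => H) _).snoc_smul x c u
  rw [LinearMap.smul_apply, creation_pure, creation_pure]
  exact (congrArg (incl J hα hq (n + 1)) h).trans (map_smul _ _ _)

end FockSpace

end

end TypeB

/-! ### Boundedness of the creation operators. -/

namespace TypeB

/-- A symmetric operator for a semi-inner product whose powers grow at most like `C ^ m` on a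
vector `f` satisfies `‖T f‖ ≤ C ‖f‖`. -/
lemma norm_apply_le_of_isSymmetric {V : Type*} [SeminormedAddCommGroup V] [InnerProductSpace ℂ V]
    {T : V →ₗ[ℂ] V} (hT : T.IsSymmetric) {f : V} {C K : ℝ} (hC : 0 < C)
    (h : ∀ m : ℕ, ‖(T ^ m) f‖ ≤ K * C ^ m) : ‖T f‖ ≤ C * ‖f‖ := by
  -- Cauchy–Schwarz after moving `T ^ m` to the other side. Iterated along powers of two, it makes
  -- any ratio `‖T f‖ / ‖f‖` above `C` produce growth faster than `C ^ m`.
  have hsq : ∀ m : ℕ, ‖(T ^ m) f‖ ^ 2 ≤ ‖f‖ * ‖(T ^ (2 * m)) f‖ := by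
    intro m
    have e : inner ℂ ((T ^ m) f) ((T ^ m) f) = inner ℂ f ((T ^ (2 * m)) f) := by
      rw [(hT.pow m) f, two_mul, pow_add]
      rfl
    calc ‖(T ^ m) f‖ ^ 2 = ‖inner ℂ ((T ^ m) f) ((T ^ m) f)‖ := by
          rw [inner_self_eq_norm_sq_to_K]
          simp
      _ ≤ _ := by
          rw [e]
          exact norm_inner_le_norm _ _
  by_contra! hlt
  -- The form may be degenerate, but a vector of seminorm zero is mapped to one of seminorm zero, by
  -- `hsq 1`.
  have hf : 0 < ‖f‖ := by
    refine lt_of_le_of_ne (norm_nonneg f) fun h0 => ?_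
    have h1 := hsq 1
    rw [← h0, zero_mul, pow_one] at h1
    rw [← h0, mul_zero] at hlt
    nlinarith
  set r := ‖T f‖ / ‖f‖ with hr
  have hr0 : 0 ≤ r := by positivity
  have hCr : 1 < r / C := by
    rw [one_lt_div hC, hr, lt_div_iff₀ hf]
    exact hlt
  have hgrow : ∀ k : ℕ, r ^ 2 ^ k * ‖f‖ ≤ ‖(T ^ 2 ^ k) f‖ := by
    intro k
    induction k with
    | zero => simp [hr, hf.ne']
    | succ k ih =>
      have h1 := hsq (2 ^ k)
      have h2 : (r ^ 2 ^ k * ‖f‖) ^ 2 ≤ ‖(T ^ 2 ^ k) f‖ ^ 2 :=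
        pow_le_pow_left₀ (by positivity) ih 2
      refine le_of_mul_le_mul_left ?_ hf
      rw [pow_succ' 2 k]
      refine le_trans (le_of_eq ?_) (h2.trans h1)
      ring
  -- Since `n ≤ 2 ^ n`, the exponent `2 ^ n` available in `hgrow` also makes the power exceed `K /
  -- ‖f‖`.
  obtain ⟨n, hn⟩ := pow_unbounded_of_one_lt (K / ‖f‖) hCr
  have h1 := (hgrow n).trans (h (2 ^ n))
  have h2 : (r / C) ^ n ≤ (r / C) ^ 2 ^ n := pow_le_pow_right₀ hCr.le Nat.lt_two_pow_self.le
  rw [div_pow r C (2 ^ n)] at h2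
  rw [← div_le_iff₀ (by positivity), mul_div_right_comm, ← le_div_iff₀ hf] at h1
  linarith

section

variable {H : Type*} [NormedAddCommGroup H] [InnerProductSpace ℂ H]

lemma SelfAdjointInvolution.norm_sign (J : SelfAdjointInvolution H) (s : ℤˣ) (x : H) :
    ‖J.sign s x‖ = ‖x‖ := by
  have h := J.inner_sign s s x x
  rw [Int.units_mul_self] at h
  simp only [sign, if_true, LinearMap.id_coe, id_eq] at h
  rw [@norm_eq_sqrt_re_inner ℂ, @norm_eq_sqrt_re_inner ℂ _ _ _ _ x]
  exact congrArg (fun z => √(RCLike.re z)) h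

namespace FockSpace

variable (J : SelfAdjointInvolution H) {α q : ℝ} (hα : α ∈ Set.Ioo (-1 : ℝ) 1)
  (hq : q ∈ Set.Ioo (-1 : ℝ) 1)

/-- A crude bound suffices: the dependence of `K` on `n` is harmless, since only the exponential
growth rate enters `norm_apply_le_of_isSymmetric`. -/
lemma norm_pure_le (n : ℕ) : ∃ K : ℝ, 0 ≤ K ∧
    ∀ x : Fin n → H, ‖pure J hα hq x‖ ≤ K * ∏ i, ‖x i‖ := by
  -- The squared norm is at most `W * P ^ 2`; as `W ≤ (1 + W) ^ 2`, the constant `1 + W` avoids a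
  -- square root.
  refine ⟨1 + ∑ π : Equiv.Perm (Fin n), ∑ s : Fin n → ℤˣ, |weight α q (ofSignedPerm (π, s))|,
    by positivity, fun x => ?_⟩
  set W := ∑ π : Equiv.Perm (Fin n), ∑ s : Fin n → ℤˣ, |weight α q (ofSignedPerm (π, s))|
  have hW : 0 ≤ W := by positivity
  set P := ∏ i, ‖x i‖ with hP
  have hP0 : 0 ≤ P := by positivity
  have h1 : ‖pure J hα hq x‖ ^ 2 = ‖inner ℂ (pure J hα hq x) (pure J hα hq x)‖ := by
    rw [inner_self_eq_norm_sq_to_K]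
    simp
  have h2 : ‖pure J hα hq x‖ ^ 2 ≤ W * P ^ 2 := by
    rw [h1, inner_pure, levelInner_eq_sum_signedPerm, Finset.sum_mul]
    refine (norm_sum_le _ _).trans (Finset.sum_le_sum fun π _ => ?_)
    rw [Finset.sum_mul]
    refine (norm_sum_le _ _).trans (Finset.sum_le_sum fun s _ => ?_)
    rw [norm_mul, Complex.norm_real, Real.norm_eq_abs]
    refine mul_le_mul_of_nonneg_left ?_ (abs_nonneg _)
    -- One copy of `P` matches the norms of the `x j`; the other is reindexed by `π` to match those
    -- of the `x (π j)`.
    rw [norm_prod, sq]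
    nth_rewrite 2 [hP]
    rw [← Equiv.prod_comp π (fun i => ‖x i‖), ← Finset.prod_mul_distrib]
    refine Finset.prod_le_prod (fun _ _ => norm_nonneg _) fun j _ => ?_
    refine (norm_inner_le_norm _ _).trans (le_of_eq ?_)
    rw [J.norm_sign]
  refine le_of_sq_le_sq ?_ (by positivity)
  refine h2.trans ?_
  rw [mul_pow]
  refine mul_le_mul_of_nonneg_right ?_ (by positivity)
  nlinarith

/-- `f` is a combination of simple tensors of degree at most `N`, of total size at most `A`. -/
inductive HasSize : ℕ → FockSpace J hα hq → ℝ → Prop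
  | pure {n N : ℕ} (hn : n ≤ N) (x : Fin n → H) : HasSize N (pure J hα hq x) (∏ i, ‖x i‖)
  | smul {N : ℕ} (c : ℂ) {f : FockSpace J hα hq} {A : ℝ} : HasSize N f A →
      HasSize N (c • f) (‖c‖ * A)
  | add {N : ℕ} {f g : FockSpace J hα hq} {A B : ℝ} : HasSize N f A → HasSize N g B →
      HasSize N (f + g) (A + B)
  | mono {N : ℕ} {f : FockSpace J hα hq} {A B : ℝ} : HasSize N f A → A ≤ B → HasSize N f B

variable {J hα hq}

lemma HasSize.zero (N : ℕ) : HasSize J hα hq N 0 0 := by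
  simpa using HasSize.smul (0 : ℂ) (HasSize.pure (J := J) (hα := hα) (hq := hq) N.zero_le Fin.elim0)

lemma HasSize.nonneg {N : ℕ} {f : FockSpace J hα hq} {A : ℝ} (h : HasSize J hα hq N f A) :
    0 ≤ A := by
  induction h with
  | pure hn x => positivity
  | smul c _ ih => positivity
  | add _ _ h1 h2 => positivity
  | mono _ h1 h2 => exact h2.trans h1

lemma HasSize.sum {ι : Type*} (s : Finset ι) {N : ℕ} {f : ι → FockSpace J hα hq} {A : ι → ℝ}
    (h : ∀ i, HasSize J hα hq N (f i) (A i)) :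
    HasSize J hα hq N (∑ i ∈ s, f i) (∑ i ∈ s, A i) := by
  classical
  induction s using Finset.induction_on with
  | empty => simpa using HasSize.zero N
  | insert a s ha ih =>
    rw [Finset.sum_insert ha, Finset.sum_insert ha]
    exact (h a).add ih

lemma HasSize.le {M N : ℕ} (hMN : M ≤ N) {f : FockSpace J hα hq} {A : ℝ}
    (h : HasSize J hα hq M f A) : HasSize J hα hq N f A := by
  induction h with
  | pure hn x => exact .pure (hn.trans hMN) x
  | smul c _ ih => exact (ih hMN).smul c
  | add _ _ h1 h2 => exact (h1 hMN).add (h2 hMN)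
  | mono _ h1 h2 => exact (h2 hMN).mono h1

lemma exists_hasSize (f : FockSpace J hα hq) : ∃ N A, HasSize J hα hq N f A := by
  induction f using induction_pure with
  | pure n x => exact ⟨n, _, .pure le_rfl x⟩
  | smul c f hf =>
    obtain ⟨N, A, h⟩ := hf
    exact ⟨N, _, h.smul c⟩
  | add f g hf hg =>
    obtain ⟨N, A, h⟩ := hf
    obtain ⟨M, B, h'⟩ := hg
    exact ⟨max N M, _, (h.le (le_max_left _ _)).add (h'.le (le_max_right _ _))⟩

-- The size dominates the seminorm with a constant that depends on the degree only. The converse is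
-- neither true in general nor needed.
variable (J hα hq) in
lemma exists_norm_le_of_hasSize (N : ℕ) : ∃ K : ℝ, ∀ (f : FockSpace J hα hq) (A : ℝ),
    HasSize J hα hq N f A → ‖f‖ ≤ K * A := by
  choose K hK0 hK using norm_pure_le J hα hq
  refine ⟨∑ n ∈ Finset.range (N + 1), K n, fun f A h => ?_⟩
  have h0 : 0 ≤ ∑ n ∈ Finset.range (N + 1), K n := Finset.sum_nonneg fun n _ => hK0 n
  induction h with
  | @pure n N hn x =>
    refine (hK n x).trans (mul_le_mul_of_nonneg_right ?_ (by positivity))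
    exact Finset.single_le_sum (f := K) (fun n _ => hK0 n) (Finset.mem_range.2 (by omega))
  | smul c _ ih =>
    rw [norm_smul, mul_left_comm]
    exact mul_le_mul_of_nonneg_left (ih h0) (norm_nonneg c)
  | add _ _ h1 h2 =>
    rw [mul_add]
    exact (norm_add_le _ _).trans (add_le_add (h1 h0) (h2 h0))
  | mono _ h1 h2 => exact (h2 h0).trans (mul_le_mul_of_nonneg_left h1 h0)

lemma HasSize.creation (u : H) {N : ℕ} {f : FockSpace J hα hq} {A : ℝ}
    (h : HasSize J hα hq N f A) :
    HasSize J hα hq (N + 1) (creation J hα hq u f) (‖u‖ * A) := by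
  induction h with
  | pure hn x =>
    rw [creation_pure]
    refine (HasSize.pure (by omega) _).mono (le_of_eq ?_)
    simp [Fin.prod_univ_castSucc, mul_comm]
  | smul c _ ih =>
    rw [map_smul]
    exact (ih.smul c).mono (le_of_eq (by ring))
  | add _ _ h1 h2 =>
    rw [map_add]
    exact (h1.add h2).mono (le_of_eq (by ring))
  | mono _ h1 h2 => exact h2.mono (mul_le_mul_of_nonneg_left h1 (norm_nonneg u))

lemma norm_removalFunctional_le (u y : H) {n : ℕ} (k : Fin (n + 1)) :
    ‖removalFunctional J α q u k y‖ ≤ (∑ t, |removalWeight α q k t|) * (‖u‖ * ‖y‖) := by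
  simp only [removalFunctional, LinearMap.sum_apply, LinearMap.smul_apply, LinearMap.comp_apply]
  rw [Finset.sum_mul]
  refine (norm_sum_le _ _).trans (Finset.sum_le_sum fun t _ => ?_)
  rw [norm_smul, Complex.norm_real, Real.norm_eq_abs]
  refine mul_le_mul_of_nonneg_left ?_ (abs_nonneg _)
  refine (norm_inner_le_norm u _).trans (le_of_eq ?_)
  rw [J.norm_sign]

/-- The factor does not depend on `N`: removing the `k`-th factor costs its removal weight, and
these weights are summable uniformly in the degree. -/
lemma HasSize.annihilation (u : H) {N : ℕ} {f : FockSpace J hα hq} {A : ℝ}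
    (h : HasSize J hα hq (N + 1) f A) :
    HasSize J hα hq N (annihilation J hα hq u f) (2 / (1 - |q|) * ‖u‖ * A) := by
  have hq' : 0 < 1 - |q| := sub_pos.2 (abs_lt.2 hq)
  have hc : 0 ≤ 2 / (1 - |q|) * ‖u‖ := by positivity
  generalize hM : N + 1 = M at h
  induction h with
  | @pure n M hn x =>
    cases n with
    | zero =>
      rw [annihilation_pure_zero]
      exact (HasSize.zero N).mono (by positivity)
    | succ n =>
      rw [annihilation_pure_succ]
      have h0 : ∀ k : Fin (n + 1), HasSize J hα hq N
          (removalFunctional J α q u k (x k) • FockSpace.pure J hα hq (k.removeNth x))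
          (‖removalFunctional J α q u k (x k)‖ * ∏ i, ‖k.removeNth x i‖) := fun k =>
        (HasSize.pure (by omega) (k.removeNth x)).smul _
      refine (HasSize.sum Finset.univ h0).mono ?_
      calc ∑ k : Fin (n + 1), ‖removalFunctional J α q u k (x k)‖ * ∏ i, ‖k.removeNth x i‖
          ≤ ∑ k : Fin (n + 1), (∑ t, |removalWeight α q k t|) * (‖u‖ * ∏ i, ‖x i‖) := by
            refine Finset.sum_le_sum fun k _ => ?_
            have h1 : ‖x k‖ * ∏ i, ‖k.removeNth x i‖ = ∏ i, ‖x i‖ :=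
              Fin.mul_prod_removeNth k fun i => ‖x i‖
            rw [← h1, ← mul_assoc ‖u‖, ← mul_assoc]
            exact mul_le_mul_of_nonneg_right (norm_removalFunctional_le u (x k) k)
              (by positivity)
        _ ≤ _ := by
            rw [← Finset.sum_mul, mul_assoc]
            exact mul_le_mul_of_nonneg_right (sum_abs_removalWeight_le hα hq n) (by positivity)
  | smul c _ ih =>
    rw [map_smul]
    exact ((ih hM).smul c).mono (le_of_eq (by ring))
  | add _ _ h1 h2 =>
    rw [map_add]
    exact ((h1 hM).add (h2 hM)).mono (le_of_eq (by ring))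
  | mono _ h1 h2 => exact (h2 hM).mono (mul_le_mul_of_nonneg_left h1 hc)

-- Creation followed by annihilation returns to degree at most `N` and multiplies the size by at
-- most `C`, so the powers of this symmetric operator grow at most like `C ^ m` on each vector.
-- Finally `‖B*(u) f‖² = ⟨f, T f⟩`.
variable (J hα hq) in
lemma exists_norm_creation_le (u : H) : ∃ C : ℝ, ∀ f : FockSpace J hα hq,
    ‖creation J hα hq u f‖ ≤ C * ‖f‖ := by
  have hq' : 0 < 1 - |q| := sub_pos.2 (abs_lt.2 hq)
  -- The summand 1 keeps `C` positive when `u = 0`.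
  set C := 2 / (1 - |q|) * ‖u‖ * ‖u‖ + 1 with hC
  have hC0 : 0 < C := by positivity
  set T := annihilation J hα hq u ∘ₗ creation J hα hq u with hT
  have hTf : ∀ f g, inner ℂ f (T g) = inner ℂ (creation J hα hq u f) (creation J hα hq u g) :=
    fun f g => (inner_creation_left J hα hq u f _).symm
  have hsymm : T.IsSymmetric := by
    intro f g
    rw [hTf, ← inner_conj_symm, hTf, inner_conj_symm]
  refine ⟨√C, fun f => ?_⟩
  obtain ⟨N, A, hA⟩ := exists_hasSize f
  obtain ⟨K, hK⟩ := exists_norm_le_of_hasSize J hα hq N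
  have hpow : ∀ m : ℕ, HasSize J hα hq N ((T ^ m) f) (C ^ m * A) := by
    intro m
    induction m with
    | zero => simpa using hA
    | succ m ih =>
      rw [pow_succ' T, Module.End.mul_apply]
      refine ((ih.creation u).annihilation u).mono ?_
      have h0 : 0 ≤ C ^ m * A := ih.nonneg
      rw [pow_succ' C, mul_assoc C, hC]
      nlinarith
  have h1 : ‖T f‖ ≤ C * ‖f‖ := norm_apply_le_of_isSymmetric hsymm (K := K * A) hC0 fun m =>
    (hK _ _ (hpow m)).trans (le_of_eq (by ring))
  have h2 : ‖creation J hα hq u f‖ ^ 2 ≤ C * ‖f‖ ^ 2 := by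
    calc ‖creation J hα hq u f‖ ^ 2
        = ‖inner ℂ (creation J hα hq u f) (creation J hα hq u f)‖ := by
          rw [inner_self_eq_norm_sq_to_K]
          simp
      _ ≤ ‖f‖ * ‖T f‖ := by
          rw [← hTf]
          exact norm_inner_le_norm _ _
      _ ≤ ‖f‖ * (C * ‖f‖) := mul_le_mul_of_nonneg_left h1 (norm_nonneg f)
      _ = _ := by ring
  refine le_of_sq_le_sq ?_ (by positivity)
  rwa [mul_pow, Real.sq_sqrt hC0.le]

variable (J hα hq)

/-- The bounded extension of the creation operator. -/
noncomputable def creationCLM (u : H) : Completed J hα hq →L[ℂ] Completed J hα hq :=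
  ((creation J hα hq u).mkContinuousOfExistsBound (exists_norm_creation_le J hα hq u)).completion

lemma creationCLM_coe (u : H) (f : FockSpace J hα hq) :
    creationCLM J hα hq u f = (creation J hα hq u f : FockSpace J hα hq) :=
  ContinuousLinearMap.completion_apply_coe _ f

variable {J hα hq} in
lemma clm_ext {A B : Completed J hα hq →L[ℂ] Completed J hα hq}
    (h : ∀ f : FockSpace J hα hq, A f = B f) : A = B := by
  ext z
  induction z using UniformSpace.Completion.induction_on with
  | hp => exact isClosed_eq A.continuous B.continuous
  | ih f => exact h f

lemma isCreation_iff (u : H) (C : Completed J hα hq →L[ℂ] Completed J hα hq) :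
    IsCreation J hα hq u C ↔ C = creationCLM J hα hq u := by
  constructor
  · exact fun h => clm_ext fun f => (h f).trans (creationCLM_coe J hα hq u f).symm
  · rintro rfl
    exact creationCLM_coe J hα hq u

/-- The Gaussian operator. -/
noncomputable def gaussian (u : H) : Completed J hα hq →L[ℂ] Completed J hα hq :=
  ContinuousLinearMap.adjoint (creationCLM J hα hq u) + creationCLM J hα hq u

lemma isGaussian_iff (u : H) (G : Completed J hα hq →L[ℂ] Completed J hα hq) :
    IsGaussian J hα hq u G ↔ G = gaussian J hα hq u := by
  simp [IsGaussian, isCreation_iff, gaussian]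

lemma adjoint_gaussian (u : H) :
    ContinuousLinearMap.adjoint (gaussian J hα hq u) = gaussian J hα hq u := by
  simp [gaussian, add_comm]

/-- The Hilbert space adjoint is tested against the dense algebraic space, where
`inner_creation_left` applies. So the Gaussian operators leave the image of the algebraic space
invariant and can be computed there. -/
lemma adjoint_creationCLM_coe (u : H) (f : FockSpace J hα hq) :
    ContinuousLinearMap.adjoint (creationCLM J hα hq u) f =
      (annihilation J hα hq u f : FockSpace J hα hq) := by
  refine ext_inner_left ℂ fun z => ?_
  induction z using UniformSpace.Completion.induction_on with
  | hp => exact isClosed_eq (by fun_prop) (by fun_prop)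
  | ih g =>
    rw [ContinuousLinearMap.adjoint_inner_right, creationCLM_coe,
      UniformSpace.Completion.inner_coe, UniformSpace.Completion.inner_coe, inner_creation_left]

lemma gaussian_coe (u : H) (f : FockSpace J hα hq) : gaussian J hα hq u f =
    ((annihilation J hα hq u f + creation J hα hq u f : FockSpace J hα hq) :
      Completed J hα hq) := by
  rw [UniformSpace.Completion.coe_add, ← creationCLM_coe, ← adjoint_creationCLM_coe]
  rfl

end FockSpace

end

end TypeB

/-! ### Vacuum moments up to order four, and the failure of traciality for nonzero `α`. -/

namespace TypeB

/-- The operators commuting with `S` and its adjoints form a set closed under adjoints, so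
commutation of `T` with `star U` need not be required separately. -/
lemma mem_generatedVonNeumannAlgebra_iff {K : Type*} [NormedAddCommGroup K]
    [InnerProductSpace ℂ K] [CompleteSpace K] {S : Set (K →L[ℂ] K)} {T : K →L[ℂ] K} :
    T ∈ generatedVonNeumannAlgebra S ↔ ∀ U : K →L[ℂ] K,
      (∀ G ∈ S, G * U = U * G ∧ star G * U = U * star G) → U * T = T * U := by
  change T ∈ StarSubalgebra.centralizer ℂ (StarSubalgebra.centralizer ℂ S : Set _) ↔ _
  rw [StarSubalgebra.mem_centralizer_iff]
  constructor
  · intro h U hU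
    exact (h U (StarSubalgebra.mem_centralizer_iff ℂ |>.2 hU)).1
  · intro h U hU
    exact ⟨h U (StarSubalgebra.mem_centralizer_iff ℂ |>.1 hU),
      h (star U) (StarSubalgebra.mem_centralizer_iff ℂ |>.1 (star_mem hU))⟩

lemma subset_generatedVonNeumannAlgebra {K : Type*} [NormedAddCommGroup K]
    [InnerProductSpace ℂ K] [CompleteSpace K] {S : Set (K →L[ℂ] K)} {T : K →L[ℂ] K} (hT : T ∈ S) :
    T ∈ generatedVonNeumannAlgebra S :=
  mem_generatedVonNeumannAlgebra_iff.2 fun _ hU => (hU T hT).1.symm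

section

variable {H : Type*} [NormedAddCommGroup H] [InnerProductSpace ℂ H]

lemma SelfAdjointInvolution.inner_conj_left (J : SelfAdjointInvolution H) (x y : H) :
    inner ℂ (J.toLinearMap x) y = inner ℂ x (J.toLinearMap y) := J.symmetric x y

lemma removalFunctional_apply (J : SelfAdjointInvolution H) (α q : ℝ) (u y : H) {n : ℕ}
    (k : Fin (n + 1)) : FockSpace.removalFunctional J α q u k y =
      (q : ℂ) ^ (n - (k : ℕ)) * inner ℂ u y +
        α * (q : ℂ) ^ (n + (k : ℕ)) * inner ℂ u (J.toLinearMap y) := by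
  have hs : (-1 : ℤˣ) ≠ 1 := by decide
  simp only [FockSpace.removalFunctional]
  rw [show (Finset.univ : Finset ℤˣ) = {1, -1} from rfl, Finset.sum_pair (by decide)]
  simp [removalWeight, SelfAdjointInvolution.sign, hs]

/-- The deformed inner product on the one-particle space. -/
noncomputable def oneParticleInner (J : SelfAdjointInvolution H) (α : ℝ) (x y : H) : ℂ :=
  inner ℂ x y + α * inner ℂ x (J.toLinearMap y)

lemma conj_oneParticleInner (J : SelfAdjointInvolution H) (α : ℝ) (x y : H) :
    (starRingEnd ℂ) (oneParticleInner J α x y) = oneParticleInner J α y x := by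
  simp [oneParticleInner, inner_conj_symm, J.inner_conj_left]

namespace FockSpace

variable (J : SelfAdjointInvolution H) {α q : ℝ} (hα : α ∈ Set.Ioo (-1 : ℝ) 1)
  (hq : q ∈ Set.Ioo (-1 : ℝ) 1)

lemma inner_gaussian_left (u : H) (z w : Completed J hα hq) :
    inner ℂ (gaussian J hα hq u z) w = inner ℂ z (gaussian J hα hq u w) := by
  rw [← ContinuousLinearMap.adjoint_inner_right, adjoint_gaussian]

lemma annihilation_vacuum (u : H) : annihilation J hα hq u (vacuum J hα hq) = 0 :=
  annihilation_pure_zero J hα hq u _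

lemma creation_vacuum (u : H) :
    creation J hα hq u (vacuum J hα hq) = pure J hα hq (fun _ : Fin 1 => u) := by
  rw [vacuum_eq, creation_pure]
  congr 1

lemma gaussian_vacuum (u : H) : gaussian J hα hq u (vacuum J hα hq : Completed J hα hq) =
    (pure J hα hq (fun _ : Fin 1 => u) : Completed J hα hq) := by
  rw [gaussian_coe, annihilation_vacuum, creation_vacuum, zero_add]

lemma annihilation_one (u v : H) : annihilation J hα hq u (pure J hα hq (fun _ : Fin 1 => v)) =
    oneParticleInner J α u v • vacuum J hα hq := by
  rw [annihilation_pure_succ]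
  rw [Fin.sum_univ_succ, Finset.univ_eq_empty, Finset.sum_empty, add_zero,
    removalFunctional_apply, oneParticleInner, vacuum_eq,
    Subsingleton.elim (Fin.removeNth 0 fun _ : Fin 1 => v) Fin.elim0]
  simp

lemma inner_vacuum : inner ℂ (vacuum J hα hq) (vacuum J hα hq) = 1 := by
  rw [vacuum_eq, inner_pure, levelInner_eq_sum_signedPerm]
  simp [weight_ofSignedPerm]

lemma inner_one (u v : H) : inner ℂ (pure J hα hq (fun _ : Fin 1 => u))
    (pure J hα hq (fun _ : Fin 1 => v)) = oneParticleInner J α u v := by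
  rw [← creation_vacuum J hα hq u, inner_creation_left, annihilation_one, inner_smul_right,
    inner_vacuum, mul_one]

lemma annihilation_two (u v w : H) : annihilation J hα hq u
    (pure J hα hq (Fin.snoc (fun _ : Fin 1 => v) w : Fin 2 → H)) =
    (q * oneParticleInner J α u v) • pure J hα hq (fun _ : Fin 1 => w) +
    (inner ℂ u w + α * q ^ 2 * inner ℂ u (J.toLinearMap w)) •
      pure J hα hq (fun _ : Fin 1 => v) := by
  rw [annihilation_pure_succ, Fin.sum_univ_two]
  have h0 : Fin.removeNth 0 (Fin.snoc (fun _ : Fin 1 => v) w : Fin 2 → H) = fun _ : Fin 1 => w := by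
    ext k
    rw [Subsingleton.elim k 0]
    rfl
  have h1 : Fin.removeNth 1 (Fin.snoc (fun _ : Fin 1 => v) w : Fin 2 → H) = fun _ : Fin 1 => v := by
    ext k
    rw [Subsingleton.elim k 0]
    rfl
  have e0 : (Fin.snoc (fun _ : Fin 1 => v) w : Fin 2 → H) 0 = v := rfl
  have e1 : (Fin.snoc (fun _ : Fin 1 => v) w : Fin 2 → H) 1 = w := rfl
  rw [h0, h1, e0, e1, removalFunctional_apply, removalFunctional_apply]
  congr 2
  · simp [oneParticleInner]
    ring
  · simp

lemma vacuumState_gaussian_two (x y : H) :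
    vacuumState J hα hq (gaussian J hα hq x * gaussian J hα hq y) = oneParticleInner J α x y := by
  rw [vacuumState, mul_apply_eq_comp, ← inner_gaussian_left, gaussian_vacuum,
    gaussian_vacuum, UniformSpace.Completion.inner_coe, inner_one]

lemma gaussian_gaussian_vacuum (x y : H) :
    gaussian J hα hq x (gaussian J hα hq y (vacuum J hα hq : Completed J hα hq)) =
      ((oneParticleInner J α x y • vacuum J hα hq +
        pure J hα hq (Fin.snoc (fun _ : Fin 1 => y) x : Fin 2 → H) : FockSpace J hα hq) :
        Completed J hα hq) := by
  rw [gaussian_vacuum, gaussian_coe, annihilation_one, creation_pure]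

/-- Self-adjointness turns the moment into the inner product of `G(y) G(x) Ω` and `G(z) G(w) Ω`,
each a multiple of `Ω` plus a two-particle tensor. The coefficient of the inner pairing `(y, z)`
carries `α * q ^ 2` where the other pairings carry `α`; this asymmetry under cyclic shifts is what
obstructs the trace. -/
lemma vacuumState_gaussian_four (x y z w : H) :
    vacuumState J hα hq (gaussian J hα hq x * (gaussian J hα hq y *
      (gaussian J hα hq z * gaussian J hα hq w))) =
      oneParticleInner J α x y * oneParticleInner J α z w +
      q * oneParticleInner J α y w * oneParticleInner J α x z +
      (inner ℂ y z + α * q ^ 2 * inner ℂ y (J.toLinearMap z)) * oneParticleInner J α x w := by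
  have e : ∀ (n : ℕ) (v : Fin (n + 1) → H), inner ℂ (vacuum J hα hq) (pure J hα hq v) = 0 :=
    fun n v => inner_pure_of_ne J hα hq (by omega) _ _
  have e' : ∀ (n : ℕ) (v : Fin (n + 1) → H), inner ℂ (pure J hα hq v) (vacuum J hα hq) = 0 :=
    fun n v => inner_pure_of_ne J hα hq (by omega) _ _
  simp only [vacuumState, mul_apply_eq_comp]
  rw [← inner_gaussian_left, ← inner_gaussian_left, gaussian_gaussian_vacuum,
    gaussian_gaussian_vacuum, UniformSpace.Completion.inner_coe]
  have h : inner ℂ (pure J hα hq (Fin.snoc (fun _ : Fin 1 => x) y : Fin 2 → H))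
      (pure J hα hq (Fin.snoc (fun _ : Fin 1 => w) z : Fin 2 → H)) =
      q * oneParticleInner J α y w * oneParticleInner J α x z +
      (inner ℂ y z + α * q ^ 2 * inner ℂ y (J.toLinearMap z)) * oneParticleInner J α x w := by
    rw [← creation_pure, inner_creation_left, annihilation_two, inner_add_right,
      inner_smul_right, inner_smul_right, inner_one, inner_one]
  rw [inner_add_left, inner_add_right, inner_add_right, h, inner_smul_left, inner_smul_right,
    inner_vacuum, inner_smul_left, inner_smul_right, e, e', conj_oneParticleInner]
  ring

end FockSpace

end

section

variable {E : Type*} [NormedAddCommGroup E] [InnerProductSpace ℝ E]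

lemma Complexification.eq_zero_of_inner_ofReal {z : Complexification E}
    (h : ∀ y : E, inner ℂ z (ofReal y) = 0) : z = 0 := by
  have h1 := congrArg Complex.re (h z.re)
  have h2 := congrArg Complex.im (h z.im)
  simp only [inner_def, ofReal, inner_zero_right, add_zero, zero_sub, Complex.zero_re,
    Complex.zero_im, neg_eq_zero] at h1 h2
  exact Complexification.ext (inner_self_eq_zero.1 h1) (inner_self_eq_zero.1 h2)

namespace FockSpace

open Complexification

/-- Cyclicity of moments of order two and four would make the form `⟨·, J ·⟩` on real vectors so
rigid that, in dimension at least 2, `J` would kill a nonzero real vector. -/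
lemma not_isTraceOn_of_ne_zero (hdim : 2 ≤ Module.rank ℝ E)
    (J : SelfAdjointInvolution (Complexification E)) {α q : ℝ}
    (hα : α ∈ Set.Ioo (-1 : ℝ) 1) (hq : q ∈ Set.Ioo (-1 : ℝ) 1) (hα0 : α ≠ 0)
    {A : VonNeumannAlgebra (Completed J hα hq)} (hA : ∀ x : E, gaussian J hα hq (ofReal x) ∈ A) :
    ¬ IsTraceOn A (vacuumState J hα hq) := by
  intro h
  have hα0' : (α : ℂ) ≠ 0 := Complex.ofReal_ne_zero.2 hα0
  set a : E → E → ℂ := fun x y => inner ℂ (ofReal x) (ofReal y) with ha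
  set b : E → E → ℂ := fun x y => inner ℂ (ofReal x) (J.toLinearMap (ofReal y)) with hb
  have hc : ∀ x y : E, oneParticleInner J α (ofReal x) (ofReal y) = a x y + α * b x y :=
    fun _ _ => rfl
  have hasymm : ∀ x y, a x y = a y x := fun x y => by
    simp only [ha, inner_ofReal, real_inner_comm]
  have hbsymm : ∀ x y, b x y = b y x := by
    intro x y
    have h2 := h _ (hA x) _ (hA y)
    rw [vacuumState_gaussian_two, vacuumState_gaussian_two, hc, hc, hasymm] at h2
    exact mul_left_cancel₀ hα0' (add_left_cancel h2)
  -- Self-adjointness of `J` says that conjugation exchanges the arguments of `b`; by symmetry `b`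
  -- is real.
  have hbconj : ∀ x y, (starRingEnd ℂ) (b x y) = b x y := by
    intro x y
    rw [hbsymm y x |>.symm]
    simp only [hb]
    rw [inner_conj_symm, J.inner_conj_left]
    exact hbsymm _ _
  have hq1 : (1 - q ^ 2 : ℂ) ≠ 0 := by
    have : (1 - q ^ 2 : ℝ) ≠ 0 := by
      have := abs_lt.2 hq
      rw [← sq_lt_one_iff_abs_lt_one] at this
      linarith
    exact_mod_cast this
  -- Moving `G(x)` from the front to the back of the fourth moment leaves the `q`-term unchanged;
  -- the difference of the other terms is this identity multiplied by `α * (1 - q ^ 2)`.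
  have key : ∀ x y z w, (a x y + α * b x y) * b z w = (a x w + α * b x w) * b y z := by
    intro x y z w
    have h4 := h _ (hA x) _ (mul_mem (hA y) (mul_mem (hA z) (hA w)))
    rw [mul_assoc (gaussian J hα hq (ofReal y)), mul_assoc (gaussian J hα hq (ofReal z)),
      vacuumState_gaussian_four, vacuumState_gaussian_four] at h4
    simp only [hc] at h4
    change _ + _ + (a y z + α * q ^ 2 * b y z) * _ =
      _ + _ + (a z w + α * q ^ 2 * b z w) * _ at h4
    rw [hasymm w x, hbsymm w x, hasymm z x, hbsymm z x, hasymm y x, hbsymm y x] at h4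
    refine mul_left_cancel₀ (mul_ne_zero hα0' hq1) ?_
    linear_combination h4
  have : Nontrivial E := by
    rw [← rank_pos_iff_nontrivial (R := ℝ)]
    exact lt_of_lt_of_le (by norm_num) hdim
  obtain ⟨e, he⟩ := exists_ne (0 : E)
  let f : E →ₗ[ℝ] ℝ :=
    { toFun := fun y => (b y e).re
      map_add' := fun y y' => by simp [hb, Complexification.inner_def, ofReal, inner_add_left]
      map_smul' := fun c y => by simp [hb, Complexification.inner_def, ofReal, real_inner_smul_left] }
  -- A real functional on a space of dimension at least 2 has a nontrivial kernel.
  have hf : ¬ Function.Injective f := by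
    intro hinj
    have h1 := (Cardinal.lift_le.2 hdim).trans (LinearMap.lift_rank_le_of_injective f hinj)
    rw [Module.rank_self] at h1
    simp at h1
  obtain ⟨z, hz, hz0⟩ : ∃ z, f z = 0 ∧ z ≠ 0 := by
    rw [injective_iff_map_eq_zero] at hf
    push Not at hf
    exact hf
  have hbz : b e z = 0 := by
    rw [hbsymm]
    exact Complex.ext hz (Complex.conj_eq_iff_im.1 (hbconj z e))
  -- As `J` is isometric, `|b e e| ≤ ‖e‖ ^ 2 = a e e`, and `|α| < 1`.
  have hcee : a e e + α * b e e ≠ 0 := by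
    intro h0
    have h1 : a e e = -(α * b e e) := eq_neg_of_add_eq_zero_left h0
    have hn : ‖J.toLinearMap (ofReal e)‖ = ‖ofReal e‖ := by
      have := J.norm_sign (-1) (ofReal e)
      simpa [SelfAdjointInvolution.sign, show (-1 : ℤˣ) ≠ 1 by decide] using this
    have h2 : ‖b e e‖ ≤ ‖ofReal e‖ * ‖ofReal e‖ := by
      have := norm_inner_le_norm (𝕜 := ℂ) (ofReal e) (J.toLinearMap (ofReal e))
      rwa [hn] at this
    have h3 : ‖a e e‖ = ‖ofReal e‖ * ‖ofReal e‖ := by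
      simp only [ha, inner_self_eq_norm_sq_to_K]
      simp [sq]
    have h4 : ‖ofReal e‖ ≠ 0 := by
      rw [norm_ne_zero_iff]
      exact fun h => he (congrArg Complexification.re h)
    have h5 : 0 < ‖ofReal e‖ * ‖ofReal e‖ := by positivity
    rw [h1, norm_neg, norm_mul, Complex.norm_real, Real.norm_eq_abs] at h3
    have h6 : |α| < 1 := abs_lt.2 hα
    nlinarith [abs_nonneg α]
  have hz' : ∀ y, b z y = 0 := by
    intro y
    have h1 := key e e z y
    rw [hbz, mul_zero] at h1
    exact (mul_eq_zero.1 h1).resolve_left hcee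
  have hJz : J.toLinearMap (ofReal z) = 0 := eq_zero_of_inner_ofReal fun y => by
    rw [J.inner_conj_left]
    exact hz' y
  have : ofReal z = 0 := by
    rw [← J.involutive (ofReal z), hJz, map_zero]
  exact hz0 (congrArg Complexification.re this)

end FockSpace

end

end TypeB

/-! ### A criterion for a vector state to be a trace, through the commutant. -/

namespace TypeB

section Trace

variable {K : Type*} [NormedAddCommGroup K] [InnerProductSpace ℂ K] [CompleteSpace K]

/-- The vectors `a Ω`, for those `a ∈ A` that have a partner `a'` in the commutant of `A` with
`a' Ω = a Ω` and `a'* Ω = a* Ω`. -/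
def partnerSubmodule (A : VonNeumannAlgebra K) (Ω : K) : Submodule ℂ K where
  carrier := {z | ∃ a ∈ A, ∃ a' : K →L[ℂ] K, (∀ S ∈ A, S * a' = a' * S) ∧ a' Ω = a Ω ∧
    star a' Ω = star a Ω ∧ a Ω = z}
  zero_mem' := ⟨0, zero_mem A, 0, by simp⟩
  add_mem' := by
    rintro _ _ ⟨a, ha, a', h1, h2, h3, rfl⟩ ⟨b, hb, b', h4, h5, h6, rfl⟩
    refine ⟨a + b, add_mem ha hb, a' + b', fun S hS => ?_, ?_, ?_, rfl⟩
    · rw [mul_add, add_mul, h1 S hS, h4 S hS]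
    · simp [h2, h5]
    · simp [h3, h6]
  smul_mem' := by
    rintro c _ ⟨a, ha, a', h1, h2, h3, rfl⟩
    refine ⟨c • a, A.toStarSubalgebra.smul_mem ha c, c • a', fun S hS => ?_, ?_, ?_, rfl⟩
    · rw [mul_smul_comm, smul_mul_assoc, h1 S hS]
    · simp [h2]
    · simp [h3]

/-- The partner of a product is the product of the partners in reverse order: `b' a' Ω = b' a Ω = a
b' Ω = a b Ω`, and similarly for the adjoints. -/
lemma apply_mem_partnerSubmodule {A : VonNeumannAlgebra K} {Ω z : K} {a a' : K →L[ℂ] K}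
    (ha : a ∈ A) (h1 : ∀ S ∈ A, S * a' = a' * S) (h2 : a' Ω = a Ω) (h3 : star a' Ω = star a Ω)
    (hz : z ∈ partnerSubmodule A Ω) : a z ∈ partnerSubmodule A Ω := by
  obtain ⟨b, hb, b', h4, h5, h6, rfl⟩ := hz
  have hcomm : ∀ {c : K →L[ℂ] K} {S : K →L[ℂ] K} (y : K), S * c = c * S → S (c y) = c (S y) :=
    fun y h => congrArg (fun T : K →L[ℂ] K => T y) h
  refine ⟨a * b, mul_mem ha hb, b' * a', fun S hS => ?_, ?_, ?_, rfl⟩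
  · rw [← mul_assoc, h4 S hS, mul_assoc, h1 S hS, mul_assoc]
  · rw [mul_apply_eq_comp, h2, ← hcomm Ω (h4 a ha), h5]
    rfl
  · rw [star_mul, star_mul, mul_apply_eq_comp, mul_apply_eq_comp, h6, ← h3]
    have h := congrArg star (h1 b hb)
    rw [star_mul, star_mul] at h
    exact hcomm Ω h

lemma one_mem_partnerSubmodule (A : VonNeumannAlgebra K) (Ω : K) : Ω ∈ partnerSubmodule A Ω :=
  ⟨1, one_mem A, 1, by simp⟩

/-- A vector state is a trace if enough operators have partners in the commutant. -/
theorem isTraceOn_of_dense_partnerSubmodule (A : VonNeumannAlgebra K) (Ω : K)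
    (hd : Dense (partnerSubmodule A Ω : Set K)) :
    IsTraceOn A fun T => inner ℂ Ω (T Ω) := by
  have hadj : ∀ (T : K →L[ℂ] K) (z w : K), inner ℂ (star T z) w = inner ℂ z (T w) :=
    fun T z w => ContinuousLinearMap.adjoint_inner_left T w z
  -- The trace identity when one of the two operators has a partner: replace `a` by `a'` at `Ω`,
  -- commute `a'` past `S`, and replace `a'` back by `a` on the left.
  have hpart : ∀ S ∈ A, ∀ a ∈ A, ∀ a' : K →L[ℂ] K, (∀ S ∈ A, S * a' = a' * S) → a' Ω = a Ω →
      star a' Ω = star a Ω → inner ℂ Ω (S (a Ω)) = inner ℂ (star a Ω) (S Ω) := by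
    intro S hS a _ a' h1 h2 h3
    rw [← h2, ← h3, hadj]
    exact congrArg (fun T : K →L[ℂ] K => inner ℂ Ω (T Ω)) (h1 S hS)
  have hnorm : ∀ a ∈ A, ∀ a' : K →L[ℂ] K, (∀ S ∈ A, S * a' = a' * S) → a' Ω = a Ω →
      star a' Ω = star a Ω → ‖star a Ω‖ = ‖a Ω‖ := by
    intro a ha a' h1 h2 h3
    have h := hpart (star a) (star_mem ha) a ha a' h1 h2 h3
    rw [← hadj, star_star, inner_self_eq_norm_sq_to_K, inner_self_eq_norm_sq_to_K] at h
    have h' : ‖a Ω‖ ^ 2 = ‖star a Ω‖ ^ 2 := by exact_mod_cast h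
    exact ((sq_eq_sq₀ (norm_nonneg _) (norm_nonneg _)).1 h').symm
  -- For general `D` the bound is obtained by testing against the dense vectors `a Ω`, where `hpart`
  -- and `hnorm` apply. It ensures that approximating `T Ω` also approximates `star T Ω`.
  have hle : ∀ D ∈ A, ‖star D Ω‖ ≤ ‖D Ω‖ := by
    intro D hD
    have h : ∀ z : K, ‖inner ℂ z (star D Ω)‖ ≤ ‖z‖ * ‖D Ω‖ := by
      intro z
      refine hd.induction (P := fun z => ‖inner ℂ z (star D Ω)‖ ≤ ‖z‖ * ‖D Ω‖) ?_
        (isClosed_le (by fun_prop) (by fun_prop)) z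
      rintro _ ⟨a, ha, a', h1, h2, h3, rfl⟩
      have h := hpart D hD a ha a' h1 h2 h3
      rw [← norm_inner_symm, hadj, h, ← hnorm a ha a' h1 h2 h3]
      exact norm_inner_le_norm _ _
    have h1 := h (star D Ω)
    rw [inner_self_eq_norm_sq_to_K, norm_pow, RCLike.norm_ofReal, abs_norm, sq] at h1
    rcases (norm_nonneg (star D Ω)).eq_or_lt with h2 | h2
    · rw [← h2]
      exact norm_nonneg _
    · exact le_of_mul_le_mul_left h1 h2
  intro S hS T hT
  rw [← sub_eq_zero, ← norm_le_zero_iff]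
  refine le_of_forall_pos_le_add fun ε hε => ?_
  obtain ⟨_, hz, ⟨a, ha, a', h1, h2, h3, rfl⟩⟩ :=
    Metric.dense_iff.1 hd (T Ω) (ε / (‖star S Ω‖ + ‖S Ω‖ + 1)) (by positivity)
  rw [Metric.mem_ball, dist_eq_norm] at hz
  -- Since `a` satisfies the trace identity with `S`, only the error `a - T` remains, and `hle`
  -- controls it in both terms.
  have e1 : inner ℂ Ω ((S * T) Ω) - inner ℂ Ω ((T * S) Ω) =
      inner ℂ (star (a - T) Ω) (S Ω) - inner ℂ (star S Ω) ((a - T) Ω) := by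
    have h := hpart S hS a ha a' h1 h2 h3
    rw [hadj, hadj] at *
    simp only [mul_apply_eq_comp, sub_apply, map_sub, inner_sub_right, h]
    ring
  rw [e1, zero_add]
  have h4 := hle (a - T) (sub_mem ha hT)
  have h5 : ‖(a - T) Ω‖ < ε / (‖star S Ω‖ + ‖S Ω‖ + 1) := hz
  rw [lt_div_iff₀ (by positivity)] at h5
  calc _ ≤ ‖star (a - T) Ω‖ * ‖S Ω‖ + ‖star S Ω‖ * ‖(a - T) Ω‖ :=
        (norm_sub_le _ _).trans (add_le_add (norm_inner_le_norm _ _) (norm_inner_le_norm _ _))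
    _ ≤ ‖(a - T) Ω‖ * ‖S Ω‖ + ‖star S Ω‖ * ‖(a - T) Ω‖ := by gcongr
    _ ≤ ε := by nlinarith [norm_nonneg ((a - T) Ω)]

end Trace

/-! ### The case `α = 0`: reversal of the tensor factors and left Gaussian operators. -/

section

variable {H : Type*} [NormedAddCommGroup H] [InnerProductSpace ℂ H]

/-- Without signs the exponent of `q` is the number of inversions, which conjugation by the
order-reversing permutation preserves. -/
lemma weight_zero_rev (q : ℝ) {n : ℕ} (π : Equiv.Perm (Fin n)) :
    weight 0 q (ofSignedPerm (Fin.revPerm.permCongr π, 1)) = weight 0 q (ofSignedPerm (π, 1)) := by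
  have hpair : ∀ a b : Fin n, pairWeight q (a, 1) (b, 1) = if b < a then q else 1 := by
    intro a b
    have h : ¬ ((a : ℕ) : ℤ) + 1 + (b + 1) < 0 := by omega
    simp [pairWeight, SignedIndex.val, h]
  simp only [weight_ofSignedPerm, Pi.one_apply, if_true, Finset.prod_const_one, one_mul, hpair]
  rw [← Equiv.prod_comp Fin.revPerm, Finset.prod_comm, ← Equiv.prod_comp Fin.revPerm]
  simp

/-- For `α = 0` a single minus sign annihilates the weight, leaving the sum over the symmetric
group. -/
lemma levelInner_zero_eq (J : SelfAdjointInvolution H) (q : ℝ) {n : ℕ} (x y : Fin n → H) :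
    levelInner J 0 q n (PiTensorProduct.tprod ℂ x) (PiTensorProduct.tprod ℂ y) =
      ∑ π : Equiv.Perm (Fin n), (weight 0 q (ofSignedPerm (π, 1)) : ℂ) *
        ∏ j, inner ℂ (x j) (y (π j)) := by
  rw [levelInner_eq_sum_signedPerm]
  refine Finset.sum_congr rfl fun π _ => ?_
  rw [Finset.sum_eq_single 1]
  · simp [SelfAdjointInvolution.sign]
  · intro s _ hs
    obtain ⟨k, hk⟩ := Function.ne_iff.1 hs
    rw [weight_ofSignedPerm, Finset.prod_eq_zero (Finset.mem_univ k) (if_neg hk)]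
    simp
  · simp

lemma levelInner_zero_rev (J : SelfAdjointInvolution H) (q : ℝ) {n : ℕ} (x y : Fin n → H) :
    levelInner J 0 q n (PiTensorProduct.tprod ℂ (x ∘ Fin.rev))
      (PiTensorProduct.tprod ℂ (y ∘ Fin.rev)) =
      levelInner J 0 q n (PiTensorProduct.tprod ℂ x) (PiTensorProduct.tprod ℂ y) := by
  rw [levelInner_zero_eq, levelInner_zero_eq, ← (Fin.revPerm.permCongr).sum_comp]
  refine Finset.sum_congr rfl fun π _ => ?_
  rw [weight_zero_rev, ← Equiv.prod_comp Fin.revPerm]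
  simp

namespace FockSpace

section Flip

variable (J : SelfAdjointInvolution H) {α q : ℝ} (hα : α ∈ Set.Ioo (-1 : ℝ) 1)
  (hq : q ∈ Set.Ioo (-1 : ℝ) 1)

/-- Reversal of the order of the tensor factors. -/
noncomputable def flip : FockSpace J hα hq →ₗ[ℂ] FockSpace J hα hq :=
  DirectSum.toModule ℂ ℕ _ fun n => incl J hα hq n ∘ₗ
    (PiTensorProduct.reindex ℂ (fun _ : Fin n => H) Fin.revPerm).toLinearMap

lemma flip_pure {n : ℕ} (x : Fin n → H) :
    flip J hα hq (pure J hα hq x) = pure J hα hq (x ∘ Fin.rev) := by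
  refine (DirectSum.toModule_lof ℂ n _).trans ?_
  exact congrArg (incl J hα hq n) (PiTensorProduct.reindex_tprod Fin.revPerm x)

lemma flip_flip (f : FockSpace J hα hq) : flip J hα hq (flip J hα hq f) = f := by
  have h : flip J hα hq ∘ₗ flip J hα hq = LinearMap.id := by
    refine hom_ext fun n x => ?_
    rw [LinearMap.comp_apply, flip_pure, flip_pure, LinearMap.id_apply]
    congr 1
    ext k
    simp
  exact congrArg (fun A => A f) h

/-- Multiplication by `q ^ n` on `H^{⊗ n}`. -/
noncomputable def qPow : FockSpace J hα hq →ₗ[ℂ] FockSpace J hα hq :=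
  DirectSum.toModule ℂ ℕ _ fun n => (q : ℂ) ^ n • incl J hα hq n

lemma qPow_pure {n : ℕ} (x : Fin n → H) :
    qPow J hα hq (pure J hα hq x) = (q : ℂ) ^ n • pure J hα hq x :=
  DirectSum.toModule_lof ℂ n _

lemma flip_qPow_flip (f : FockSpace J hα hq) :
    flip J hα hq (qPow J hα hq (flip J hα hq f)) = qPow J hα hq f := by
  have h : flip J hα hq ∘ₗ qPow J hα hq ∘ₗ flip J hα hq = qPow J hα hq := by
    refine hom_ext fun n x => ?_
    rw [LinearMap.comp_apply, LinearMap.comp_apply, flip_pure, qPow_pure, map_smul, ← flip_pure,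
      flip_flip, qPow_pure]
  exact congrArg (fun A => A f) h

/-- The left creation operator. -/
noncomputable def leftCreation (u : H) : FockSpace J hα hq →ₗ[ℂ] FockSpace J hα hq :=
  flip J hα hq ∘ₗ creation J hα hq u ∘ₗ flip J hα hq

/-- The left annihilation operator. -/
noncomputable def leftAnnihilation (u : H) : FockSpace J hα hq →ₗ[ℂ] FockSpace J hα hq :=
  flip J hα hq ∘ₗ annihilation J hα hq u ∘ₗ flip J hα hq

lemma leftCreation_pure (u : H) {n : ℕ} (x : Fin n → H) :
    leftCreation J hα hq u (pure J hα hq x) =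
      pure J hα hq (Fin.cons u x : Fin (n + 1) → H) := by
  rw [leftCreation, LinearMap.comp_apply, LinearMap.comp_apply, flip_pure, creation_pure,
    flip_pure]
  congr 1
  ext k
  induction k using Fin.cases with
  | zero => simp
  | succ k => simp [Fin.rev_succ]

lemma leftCreation_creation (u v : H) (f : FockSpace J hα hq) :
    leftCreation J hα hq u (creation J hα hq v f) =
      creation J hα hq v (leftCreation J hα hq u f) := by
  induction f using induction_pure with
  | pure n x =>
    rw [creation_pure, leftCreation_pure, leftCreation_pure, creation_pure]
    congr 1
    exact Fin.cons_snoc_eq_snoc_cons u x v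
  | smul c f hf => simp only [map_smul, hf]
  | add f g hf hg => simp only [map_add, hf, hg]

end Flip

section Zero

variable (J : SelfAdjointInvolution H) {q : ℝ} (h0 : (0 : ℝ) ∈ Set.Ioo (-1 : ℝ) 1)
  (hq : q ∈ Set.Ioo (-1 : ℝ) 1)

/-- For `α = 0` the exponent counts the factors to the right of the removed one. Adding a factor in
front changes none of the old exponents, and removing the new factor costs `q ^ n`. -/
lemma annihilation_leftCreation (u v : H) (f : FockSpace J h0 hq) :
    annihilation J h0 hq v (leftCreation J h0 hq u f) =
      leftCreation J h0 hq u (annihilation J h0 hq v f) + inner ℂ v u • qPow J h0 hq f := by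
  induction f using induction_pure with
  | pure n x =>
    rw [leftCreation_pure, annihilation_pure_succ, Fin.sum_univ_succ, qPow_pure, add_comm,
      Fin.cons_zero, Fin.removeNth_zero, Fin.tail_cons, removalFunctional_apply, smul_smul]
    congr 1
    · cases n with
      | zero => rw [annihilation_pure_zero, map_zero, Finset.univ_eq_empty, Finset.sum_empty]
      | succ n =>
        rw [annihilation_pure_succ, map_sum]
        refine Finset.sum_congr rfl fun k _ => ?_
        rw [map_smul, leftCreation_pure, Fin.cons_succ, removalFunctional_apply,
          removalFunctional_apply]
        congr 1
        · simp
        · congr 1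
          ext j
          induction j using Fin.cases with
          | zero => simp [Fin.removeNth_apply]
          | succ j => simp [Fin.removeNth_apply]
    · congr 1
      simp [mul_comm]
  | smul c f hf => simp only [map_smul, hf, smul_add, smul_comm c]
  | add f g hf hg =>
    simp only [map_add, hf, hg, smul_add]
    abel

lemma leftAnnihilation_creation (u v : H) (f : FockSpace J h0 hq) :
    leftAnnihilation J h0 hq u (creation J h0 hq v f) =
      creation J h0 hq v (leftAnnihilation J h0 hq u f) + inner ℂ u v • qPow J h0 hq f := by
  have h := congrArg (flip J h0 hq) (annihilation_leftCreation J h0 hq v u (flip J h0 hq f))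
  simpa only [leftCreation, leftAnnihilation, LinearMap.comp_apply, flip_flip, map_add, map_smul,
    flip_qPow_flip] using h

lemma inner_flip_flip (f g : FockSpace J h0 hq) :
    inner ℂ (flip J h0 hq f) (flip J h0 hq g) = inner ℂ f g := by
  induction f using induction_pure with
  | smul c f hf => simp only [map_smul, inner_smul_left, hf]
  | add f f' hf hf' => simp only [map_add, inner_add_left, hf, hf']
  | pure m x =>
  induction g using induction_pure with
  | smul c f hf => simp only [map_smul, inner_smul_right, hf]
  | add f f' hf hf' => simp only [map_add, inner_add_right, hf, hf']
  | pure n y =>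
  rw [flip_pure, flip_pure]
  by_cases h : m = n
  · subst h
    rw [inner_pure, inner_pure, levelInner_zero_rev]
  · rw [inner_pure_of_ne _ _ _ h, inner_pure_of_ne _ _ _ h]

/-- The unitary extension of the reversal for `α = 0`. -/
noncomputable def flipCLM : Completed J h0 hq →L[ℂ] Completed J h0 hq :=
  ((flip J h0 hq).isometryOfInner (inner_flip_flip J h0 hq)).toContinuousLinearMap.completion

lemma flipCLM_coe (f : FockSpace J h0 hq) :
    flipCLM J h0 hq f = (flip J h0 hq f : FockSpace J h0 hq) :=
  ContinuousLinearMap.completion_apply_coe _ f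

lemma star_flipCLM : star (flipCLM J h0 hq) = flipCLM J h0 hq := by
  refine clm_ext fun f => ext_inner_left ℂ fun z => ?_
  induction z using UniformSpace.Completion.induction_on with
  | hp => exact isClosed_eq (by fun_prop) (by fun_prop)
  | ih g =>
    rw [ContinuousLinearMap.star_eq_adjoint, ContinuousLinearMap.adjoint_inner_right, flipCLM_coe,
      flipCLM_coe, UniformSpace.Completion.inner_coe, UniformSpace.Completion.inner_coe,
      ← inner_flip_flip, flip_flip]

/-- The left Gaussian operator. -/
noncomputable def leftGaussian (u : H) : Completed J h0 hq →L[ℂ] Completed J h0 hq :=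
  flipCLM J h0 hq * gaussian J h0 hq u * flipCLM J h0 hq

lemma star_leftGaussian (u : H) : star (leftGaussian J h0 hq u) = leftGaussian J h0 hq u := by
  rw [leftGaussian, star_mul, star_mul, star_flipCLM, mul_assoc]
  congr 2
  exact adjoint_gaussian J h0 hq u

lemma leftGaussian_vacuum (u : H) :
    leftGaussian J h0 hq u (vacuum J h0 hq : Completed J h0 hq) =
      gaussian J h0 hq u (vacuum J h0 hq : Completed J h0 hq) := by
  have h : flip J h0 hq (vacuum J h0 hq) = vacuum J h0 hq := by
    rw [vacuum_eq, flip_pure]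
    congr 1
  rw [leftGaussian, mul_apply_eq_comp, mul_apply_eq_comp, flipCLM_coe, h, gaussian_vacuum,
    flipCLM_coe, flip_pure]
  rfl

/-- Left and right creations commute, hence so do the annihilations. The mixed commutators are `⟨u,
v⟩` and `⟨v, u⟩` times `q ^ n` on level `n`, with opposite signs, and cancel by `huv`. -/
lemma leftGaussian_mul_gaussian {u v : H} (huv : (inner ℂ u v : ℂ) = inner ℂ v u) :
    gaussian J h0 hq v * leftGaussian J h0 hq u = leftGaussian J h0 hq u * gaussian J h0 hq v := by
  set F := flipCLM J h0 hq with hF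
  set C := creationCLM J h0 hq v with hC
  set D := creationCLM J h0 hq u with hD
  have hstar : ∀ (w : H) (f : FockSpace J h0 hq), star (creationCLM J h0 hq w) f =
      (annihilation J h0 hq w f : FockSpace J h0 hq) := adjoint_creationCLM_coe J h0 hq
  have h1 : F * D * F * C = C * (F * D * F) := clm_ext fun f => by
    simp only [mul_apply_eq_comp, hF, hC, hD, flipCLM_coe, creationCLM_coe]
    exact congrArg _ (leftCreation_creation J h0 hq u v f)
  -- This is the adjoint of `h1`, as `F` is self-adjoint.
  have h2 : F * star D * F * star C = star C * (F * star D * F) := by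
    have h := congrArg star h1
    simp only [star_mul, star_flipCLM, hF] at h
    simp only [hF, mul_assoc] at h ⊢
    exact h.symm
  have h3 : F * star D * F * C + F * D * F * star C =
      C * (F * star D * F) + star C * (F * D * F) := clm_ext fun f => by
    have e1 := leftAnnihilation_creation J h0 hq u v f
    have e2 := annihilation_leftCreation J h0 hq u v f
    simp only [leftCreation, leftAnnihilation, LinearMap.comp_apply] at e1 e2
    simp only [add_apply, mul_apply_eq_comp, hF, hC, hD, flipCLM_coe,
      creationCLM_coe, hstar, e1, e2, ← UniformSpace.Completion.coe_add]
    rw [huv]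
    congr 1
    abel
  have e1 : gaussian J h0 hq v = star C + C := rfl
  have e2 : gaussian J h0 hq u = star D + D := rfl
  rw [leftGaussian, e1, e2]
  calc (star C + C) * (F * (star D + D) * F)
      = star C * (F * star D * F) + (C * (F * star D * F) + star C * (F * D * F)) +
        C * (F * D * F) := by noncomm_ring
    _ = _ := by
      rw [← h1, ← h2, ← h3]
      noncomm_ring

end Zero

end FockSpace

end

/-! ### Traciality for `α = 0`. -/

section

variable {E : Type*} [NormedAddCommGroup E] [InnerProductSpace ℝ E]

namespace FockSpace

open Complexification

/-- The left Gaussian operators are the partners of the right ones, so the partner subspace contains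
`Ω` and is stable under every `G(x)` with `x` real. It remains to see that it contains all simple
tensors. -/
lemma isTraceOn_zero (J : SelfAdjointInvolution (Complexification E)) {q : ℝ}
    (h0 : (0 : ℝ) ∈ Set.Ioo (-1 : ℝ) 1) (hq : q ∈ Set.Ioo (-1 : ℝ) 1) :
    IsTraceOn (generatedVonNeumannAlgebra {G | ∃ x : E, IsGaussian J h0 hq (ofReal x) G})
      (vacuumState J h0 hq) := by
  set A := generatedVonNeumannAlgebra {G | ∃ x : E, IsGaussian J h0 hq (ofReal x) G} with hA
  refine isTraceOn_of_dense_partnerSubmodule A (vacuum J h0 hq : Completed J h0 hq) ?_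
  set P := partnerSubmodule A (vacuum J h0 hq : Completed J h0 hq) with hP
  have hG : ∀ (x : E) (z), z ∈ P → gaussian J h0 hq (ofReal x) z ∈ P := by
    intro x z hz
    refine apply_mem_partnerSubmodule (a' := leftGaussian J h0 hq (ofReal x))
      (subset_generatedVonNeumannAlgebra ⟨x, (isGaussian_iff J h0 hq _ _).2 rfl⟩) ?_
      (leftGaussian_vacuum J h0 hq _) ?_ hz
    · intro S hS
      refine (mem_generatedVonNeumannAlgebra_iff.1 hS _ ?_).symm
      rintro G ⟨y, hy⟩
      rw [isGaussian_iff] at hy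
      subst hy
      have h : gaussian J h0 hq (ofReal y) * leftGaussian J h0 hq (ofReal x) =
          leftGaussian J h0 hq (ofReal x) * gaussian J h0 hq (ofReal y) :=
        leftGaussian_mul_gaussian J h0 hq (by rw [inner_ofReal, inner_ofReal, real_inner_comm])
      refine ⟨h, ?_⟩
      rw [show star (gaussian J h0 hq (ofReal y)) = gaussian J h0 hq (ofReal y) from
        adjoint_gaussian J h0 hq _]
      exact h
    · rw [star_leftGaussian, leftGaussian_vacuum]
      rw [show star (gaussian J h0 hq (ofReal x)) = gaussian J h0 hq (ofReal x) from
        adjoint_gaussian J h0 hq _]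
  have hpure : ∀ (n : ℕ) (v : Fin n → Complexification E),
      ((pure J h0 hq v : FockSpace J h0 hq) : Completed J h0 hq) ∈ P := by
    intro n
    -- A tensor ending in a real vector `x` is `G(x)` applied to its initial part, minus an
    -- annihilation term two degrees lower; the step back by two calls for strong induction.
    induction n using Nat.strong_induction_on with
    | _ n ih =>
    intro v
    cases n with
    | zero =>
      rw [Subsingleton.elim v Fin.elim0]
      exact one_mem_partnerSubmodule A _
    | succ n =>
      have hann : ∀ u, ((annihilation J h0 hq u (pure J h0 hq (Fin.init v)) :
          FockSpace J h0 hq) : Completed J h0 hq) ∈ P := by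
        intro u
        cases n with
        | zero =>
          rw [annihilation_pure_zero, UniformSpace.Completion.coe_zero]
          exact zero_mem P
        | succ n =>
          rw [annihilation_pure_succ]
          have e : ∀ (s : Finset (Fin (n + 1))) (g : Fin (n + 1) → FockSpace J h0 hq),
              (∀ k, (g k : Completed J h0 hq) ∈ P) →
              ((∑ k ∈ s, g k : FockSpace J h0 hq) : Completed J h0 hq) ∈ P := by
            intro s g hg
            rw [show ((∑ k ∈ s, g k : FockSpace J h0 hq) : Completed J h0 hq) =
              ∑ k ∈ s, (g k : Completed J h0 hq) from
                map_sum (UniformSpace.Completion.toComplₗᵢ (𝕜 := ℂ)) g s]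
            exact sum_mem fun k _ => hg k
          refine e _ _ fun k => ?_
          rw [UniformSpace.Completion.coe_smul]
          exact P.smul_mem _ (ih n (by omega) _)
      have hreal : ∀ x : E, ((creation J h0 hq (ofReal x) (pure J h0 hq (Fin.init v)) :
          FockSpace J h0 hq) : Completed J h0 hq) ∈ P := by
        intro x
        have h1 := P.sub_mem (hG x _ (ih n (by omega) (Fin.init v))) (hann (ofReal x))
        rwa [gaussian_coe, UniformSpace.Completion.coe_add, add_sub_cancel_left] at h1
      -- Only real vectors give Gaussian operators in the algebra, so a complex last factor is split
      -- into real and imaginary parts.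
      have hv : v (Fin.last n) = ofReal (v (Fin.last n)).re +
          Complex.I • ofReal (v (Fin.last n)).im := by
        ext <;> simp [ofReal]
      have h : pure J h0 hq v = creation J h0 hq (ofReal (v (Fin.last n)).re)
          (pure J h0 hq (Fin.init v)) + Complex.I •
          creation J h0 hq (ofReal (v (Fin.last n)).im) (pure J h0 hq (Fin.init v)) := by
        rw [← LinearMap.smul_apply, ← creation_smul, ← LinearMap.add_apply, ← creation_add, ← hv,
          creation_pure, Fin.snoc_init_self]
      rw [h, UniformSpace.Completion.coe_add, UniformSpace.Completion.coe_smul]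
      exact P.add_mem (hreal _) (P.smul_mem _ (hreal _))
  refine UniformSpace.Completion.denseRange_coe.mono ?_
  rintro _ ⟨f, rfl⟩
  change (f : Completed J h0 hq) ∈ P
  induction f using induction_pure with
  | pure n x => exact hpure n x
  | smul c f hf =>
    rw [UniformSpace.Completion.coe_smul]
    exact P.smul_mem c hf
  | add f g hf hg =>
    rw [UniformSpace.Completion.coe_add]
    exact P.add_mem hf hg

end FockSpace

end

end TypeB

theorem mainTheorem8 {E : Type*} [NormedAddCommGroup E] [InnerProductSpace ℝ E]
    [CompleteSpace E] [TopologicalSpace.SeparableSpace E] (hdim : 2 ≤ Module.rank ℝ E)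
    (J : TypeB.SelfAdjointInvolution (TypeB.Complexification E))
    {α q : ℝ} (hα : α ∈ Set.Ioo (-1 : ℝ) 1) (hq : q ∈ Set.Ioo (-1 : ℝ) 1) :
    (∀ x : E, ∃! G : TypeB.FockSpace.Completed J hα hq →L[ℂ] TypeB.FockSpace.Completed J hα hq,
      TypeB.FockSpace.IsGaussian J hα hq (TypeB.Complexification.ofReal x) G) ∧
    (TypeB.IsTraceOn
      (TypeB.generatedVonNeumannAlgebra
        {G | ∃ x : E, TypeB.FockSpace.IsGaussian J hα hq (TypeB.Complexification.ofReal x) G})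
      (TypeB.FockSpace.vacuumState J hα hq) ↔ α = 0) := by
  have hG := TypeB.FockSpace.isGaussian_iff J hα hq
  refine ⟨fun x => ?_, fun h => ?_, ?_⟩
  · exact ⟨_, (hG _ _).2 rfl, fun G h => (hG _ G).1 h⟩
  · by_contra hα0
    refine TypeB.FockSpace.not_isTraceOn_of_ne_zero hdim J hα hq hα0 ?_ h
    exact fun x => TypeB.subset_generatedVonNeumannAlgebra ⟨x, (hG _ _).2 rfl⟩
  · rintro rfl
    exact TypeB.FockSpace.isTraceOn_zero J hα hq
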